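/- Let $n\ge 1$, $d\ge 2$, and let $p,q\ge 0$ be integers with $p+q=n$. Let $\kappa_n=\binom{n+d-1}{d-1}$, and let $\mu_H$ be the image of the Haar probability measure on $U(d)$ under $U\mapsto U|0\rangle\langle 0|U^\dagger$. Write $P_\pi$ ($\pi\in S_n$) for the operators permuting the tensor factors of $(\mathbb C^d)^{\otimes n}$, and let $\Pi_{\mathrm{sym}}=\frac1{n!}\sum_{\pi\in S_n}P_\pi$. Let $|\tau\rangle$ be a unit vector that lies in $\mathrm{span}\{P_\pi|0\rangle^{\otimes p}|1\rangle^{\otimes q}:\pi\in S_n\}$ and is a basis vector $|(\lambda,i,0)\rangle$ of a nice Schur basis for the partition $\lambda=(n)$, i.e. a unit vector in $Y_\lambda V(w)$ for a weight subspace $V(w)$ (the span of the standard basis vectors in which each symbol $j$ occurs $w_j$ times), where $Y_\lambda=\sum_{\pi\in S_n}P_\pi$ is the Young symmetrizer. Measure $|\tau\rangle$ with the row symmetric joint measurement for $\lambda=(n)$: the POVM with elements $\kappa_n\psi^{\otimes n}\,d\mu_H(\psi)$ together with the "fail" element $I-\Pi_{\mathrm{sym}}$. On outcome $\psi$ put $\Psi=(d+n)\psi$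 (the value on "fail", which has probability $0$, is irrelevant). Let $O\in\mathbb C^{d\times d}$ be Hermitian with $\operatorname{tr}(O)=0$. (1) The Born rule for this measurement is a probability distribution under which $\operatorname{tr}(O\Psi)$ is square integrable, and $$\begin{aligned}\operatorname{Var}[\operatorname{tr}(O\Psi)]=\;&\frac{n+d}{n+d+1}\Big(\operatorname{tr}(O^2)+2p\langle 0|O^2|0\rangle+2q\langle 1|O^2|1\rangle+2pq\,|\langle 0|O|1\rangle|^2-p\langle 0|O|0\rangle^2-q\langle 1|O|1\rangle^2\Big)\\&-\frac{1}{n+d+1}\Big(p^2\langle 0|O|0\rangle^2+q^2\langle 1|O|1\rangle^2+2pq\langle 0|O|0\rangle\langle 1|O|1\rangle\Big).\end{aligned}$$ (2) Suppose moreover that the upper left $2\times 2$ block of $O$ is $\begin{bmatrix}1&1\\1&-1\end{bmatrix}$ (so $\langle 0|O|1\rangle=1$; the other entries are arbitrary subject to $O$ being Hermitian and traceless) and that $p,q=\Theta(n)$. Then, for all sufficiently large $n$, $$\frac1{n^2}\operatorname{Var}[\operatorname{tr}(O\Psi)]\ \ge\ \Omega\Big(\frac{pq}{n^2}|\langle 0|O|1\rangle|^2\Big)\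 \ge\ \Omega(1).$$ Precisely: there is a universal constant $C_1>0$ such that for every $c>0$ there are $C_2>0$ and $N$, depending only on $c$, such that for all $n\ge N$, all $d\ge2$, all such $O$ and $\tau$, and all $p,q\ge cn$ with $p+q=n$, $$\frac1{n^2}\operatorname{Var}[\operatorname{tr}(O\Psi)]\ge C_1\frac{pq}{n^2}|\langle 0|O|1\rangle|^2\ge C_2.$$ (3) Consequently the $O(n^2)\|O\|_\infty^2$ term in the general upper bound $\operatorname{Var}[\operatorname{tr}(O\Psi)]\le k\operatorname{tr}(O^2)+O(n)\|O^2\|_\infty+O(n^2)\|O\|_\infty^2$ (here $k=1$; $\|\cdot\|_\infty$ is the spectral norm) cannot be removed for this measurement: for every $d\ge 2$, every $O$ as in (2), every $c>0$ and all real $A,B$ there is $N$ such that for all $n\ge N$ and all $p,q\ge cn$ with $p+q=n$ there is a state $\tau$ as above with $$\operatorname{Var}[\operatorname{tr}(O\Psi)]>A\operatorname{tr}(O^2)+B\,n\,\|O^2\|_\infty .$$ -/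

import Mathlib

open MeasureTheory ProbabilityTheory
open scoped Matrix

namespace QuditShadow

/-! ### Haar measure on the unitary group and Haar random pure states -/

/-- The product (= Borel) sigma-algebra on complex matrices. -/
noncomputable instance instMeasurableSpaceMatrix (m n : Type*) : MeasurableSpace (Matrix m n ℂ) :=
  inferInstanceAs (MeasurableSpace (m → n → ℂ))

instance instBorelSpaceMatrix (m n : Type*) [Countable m] [Countable n] :
    BorelSpace (Matrix m n ℂ) :=
  inferInstanceAs (BorelSpace (m → n → ℂ))

noncomputable instance instMeasurableSpaceUnitary (d : ℕ) : MeasurableSpace (Matrix.unitaryGroup (Fin d) ℂ) :=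
  inferInstanceAs
    (MeasurableSpace {M : Matrix (Fin d) (Fin d) ℂ // M ∈ Matrix.unitaryGroup (Fin d) ℂ})

instance instBorelSpaceUnitary (d : ℕ) : BorelSpace (Matrix.unitaryGroup (Fin d) ℂ) :=
  inferInstanceAs
    (BorelSpace {M : Matrix (Fin d) (Fin d) ℂ // M ∈ Matrix.unitaryGroup (Fin d) ℂ})

instance instCompactSpaceUnitary (d : ℕ) : CompactSpace (Matrix.unitaryGroup (Fin d) ℂ) := by
  refine isCompact_iff_compactSpace.mp ?_
  have hK : IsCompact (Set.univ.pi fun _ : Fin d => Set.univ.pi fun _ : Fin d =>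
      Metric.closedBall (0 : ℂ) 1) :=
    isCompact_univ_pi fun _ => isCompact_univ_pi fun _ => isCompact_closedBall _ _
  refine IsCompact.of_isClosed_subset (X := Fin d → Fin d → ℂ) hK ?_ ?_
  · have h : IsClosed {M : Matrix (Fin d) (Fin d) ℂ | M * star M = 1} :=
      isClosed_eq (by fun_prop) continuous_const
    have e : ((Matrix.unitaryGroup (Fin d) ℂ : Set (Matrix (Fin d) (Fin d) ℂ))) =
        {M | M * star M = 1} := Set.ext fun _ => Matrix.mem_unitaryGroup_iff
    rw [← e] at h
    exact h
  · intro M hM i _ j _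
    simpa using entry_norm_bound_of_unitary hM i j

/-- The Haar probability measure on `U(d)`: the Haar measure giving the whole (compact) group
mass one. -/
noncomputable def haarUnitary (d : ℕ) : Measure (Matrix.unitaryGroup (Fin d) ℂ) :=
  Measure.haarMeasure ⊤

/-- The pure state `U |0⟩⟨0| U†`. -/
noncomputable def rotatedState (d : ℕ) [NeZero d] (U : Matrix.unitaryGroup (Fin d) ℂ) :
    Matrix (Fin d) (Fin d) ℂ :=
  (U : Matrix (Fin d) (Fin d) ℂ) * Matrix.single 0 0 1 * (U : Matrix (Fin d) (Fin d) ℂ)ᴴ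

/-- The Haar random state measure `μ_H` on density matrices of pure states of a qudit: the image
of the Haar measure on `U(d)`. -/
noncomputable def haarState (d : ℕ) [NeZero d] : Measure (Matrix (Fin d) (Fin d) ℂ) :=
  (haarUnitary d).map (rotatedState d)

/-! ### The space `(ℂ^d)^{⊗n}`

A vector is given by its coordinates in the standard basis `|a₁, …, aₙ⟩`, and an operator by its
matrix in that basis. -/

/-- Standard basis strings, labelling the standard basis of `(ℂ^d)^{⊗n}`. -/
abbrev Str (n d : ℕ) := Fin n → Fin d

/-- The standard basis vector `|a⟩`. -/
def ket {n d : ℕ} (a : Str n d) : Str n d → ℂ := Pi.single a 1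

/-- `P_π = ∑_a |a_{π⁻¹(1)}, …, a_{π⁻¹(n)}⟩⟨a_1, …, a_n|`. -/
def permOp {n d : ℕ} (π : Equiv.Perm (Fin n)) : Matrix (Str n d) (Str n d) ℂ :=
  Matrix.of fun b a => if b = a ∘ ⇑π⁻¹ then 1 else 0

/-- The density matrix `|τ⟩⟨τ|`. -/
def pureState {n d : ℕ} (τ : Str n d → ℂ) : Matrix (Str n d) (Str n d) ℂ :=
  Matrix.vecMulVec τ (star τ)

/-- The weight vector of a string: the number of occurrences of each symbol. -/
def weight {n d : ℕ} (a : Str n d) (i : Fin d) : ℕ :=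
  (Finset.univ.filter fun s => a s = i).card

/-- The weight subspace `V(w)`. -/
def weightSpace {n d : ℕ} (w : Fin d → ℕ) : Submodule ℂ (Str n d → ℂ) :=
  Submodule.span ℂ {v | ∃ a : Str n d, weight a = w ∧ v = ket a}

/-! ### Row lengths `lam`, row and column permutations, Young symmetrizer

`lam : Composition n` is the list of the (positive) row lengths `lam_1, …, lam_k`, with
`k = lam.length`.  The boxes are numbered from left to right and then from top to bottom:
box `s` is in row `lam.index s`, at column `lam.invEmbedding s`.  A partition is the case of a
nonincreasing list; the definitions below do not need the monotonicity. -/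

/-- The row permutation group `A_lam` as a finite set of permutations. -/
def rowPerms {n : ℕ} (lam : Composition n) : Finset (Equiv.Perm (Fin n)) :=
  Finset.univ.filter fun π => ∀ s, lam.index (π s) = lam.index s

/-- The column permutation group `B_lam` as a finite set of permutations. -/
def colPerms {n : ℕ} (lam : Composition n) : Finset (Equiv.Perm (Fin n)) :=
  Finset.univ.filter fun π => ∀ s, (lam.invEmbedding (π s) : ℕ) = (lam.invEmbedding s : ℕ)

/-- The Young symmetrizer `Y_lam = ∑_{a ∈ A_lam} P_a ∑_{b ∈ B_lam} sgn(b) P_b`. -/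
def youngSymmetrizer {n : ℕ} (d : ℕ) (lam : Composition n) : Matrix (Str n d) (Str n d) ℂ :=
  (∑ a ∈ rowPerms lam, permOp a) *
    ∑ b ∈ colPerms lam, ((Equiv.Perm.sign b : ℤ) : ℂ) • permOp b

/-- `τ` can occur as a vector `|(lam, i, 0)⟩` of the nice Schur basis: these vectors form an
arbitrary orthonormal basis of `Y_lam V(w)`, for each weight `w`. So `τ` is a unit vector
in some `Y_lam V(w)`. -/
def IsSchurVector {n d : ℕ} (lam : Composition n) (τ : Str n d → ℂ) : Prop :=
  (∃ w : Fin d → ℕ, ∃ v ∈ weightSpace (n := n) w, τ = youngSymmetrizer d lam *ᵥ v) ∧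
    star τ ⬝ᵥ τ = 1

/-! ### The row symmetric joint measurement and the shadow matrix -/

/-- The dimension `κ_s` of the symmetric subspace of `(ℂ^d)^{⊗s}`. -/
def symDim (d s : ℕ) : ℕ := (s + d - 1).choose (d - 1)

/-- The projector onto the row symmetric subspace. -/
noncomputable def rowSymProj {n : ℕ} (d : ℕ) (lam : Composition n) :
    Matrix (Str n d) (Str n d) ℂ :=
  ((rowPerms lam).card : ℂ)⁻¹ • ∑ π ∈ rowPerms lam, permOp π

/-- The POVM element `F(ψ_1, …, ψ_k) = ⨂_i κ_{lam_i} ψ_i^{⊗ lam_i}`: its matrix entries are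
products of entries, the qudit in box `s` carrying the matrix `ψ_i` of its row `i`. -/
def povmElement {n d : ℕ} (lam : Composition n)
    (ψ : Fin lam.length → Matrix (Fin d) (Fin d) ℂ) : Matrix (Str n d) (Str n d) ℂ :=
  Matrix.of fun a b =>
    (∏ i, (symDim d (lam.blocksFun i) : ℂ)) * ∏ s, ψ (lam.index s) (a s) (b s)

/-- Outcomes of the measurement: a tuple `(ψ_1, …, ψ_k)` or "fail". -/
abbrev Outcome {n : ℕ} (d : ℕ) (lam : Composition n) :=
  (Fin lam.length → Matrix (Fin d) (Fin d) ℂ) ⊕ Unit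

/-- The distribution (Born rule) of the outcome of the row symmetric joint measurement on a state
with density matrix `ρ`: density `tr(F(ψ_1, …, ψ_k) ρ)` with respect to `μ_H^k` on the tuples, and
mass `tr((I - Π_sym) ρ)` on "fail". -/
noncomputable def outcomeLaw {n : ℕ} (d : ℕ) [NeZero d] (lam : Composition n)
    (ρ : Matrix (Str n d) (Str n d) ℂ) : Measure (Outcome d lam) :=
  ((Measure.pi fun _ : Fin lam.length => haarState d).withDensity
      fun ψ => ENNReal.ofReal (povmElement lam ψ * ρ).trace.re).map Sum.inl +
    ENNReal.ofReal ((1 - rowSymProj d lam) * ρ).trace.re • Measure.dirac (Sum.inr ())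

/-- The shadow matrix `Ψ = ∑_i (d + lam_i) ψ_i`. On "fail", where it is not defined, the
value is set to `0`. -/
def shadow {n d : ℕ} (lam : Composition n) : Outcome d lam → Matrix (Fin d) (Fin d) ℂ
  | Sum.inl ψ => ∑ i, ((d + lam.blocksFun i : ℕ) : ℂ) • ψ i
  | Sum.inr _ => 0

/-- The estimate `tr(O Ψ)`, which is real for Hermitian `O`, as a real random variable. -/
def estimate {n d : ℕ} (lam : Composition n) (O : Matrix (Fin d) (Fin d) ℂ)
    (x : Outcome d lam) : ℝ :=
  (O * shadow lam x).trace.re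

/-- `Var[tr(O Ψ)]`, over the outcome of the measurement on the pure state `τ`. -/
noncomputable def estimateVar {n d : ℕ} [NeZero d] (lam : Composition n) (τ : Str n d → ℂ)
    (O : Matrix (Fin d) (Fin d) ℂ) : ℝ :=
  variance (estimate lam O) (outcomeLaw d lam (pureState τ))

/-! ### The setup -/

/-- The string labelling `|0⟩^{⊗p} |1⟩^{⊗(n-p)}`. -/
def stepString (n d p : ℕ) [NeZero d] : Str n d := fun s => if (s : ℕ) < p then 0 else 1

/-- The setup with one row `lam = (n)`, `n ≥ 1`, and qudits of dimension `d ≥ 2`: natural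
numbers `p + q = n`, a vector `τ = |(lam, i, 0)⟩` in the span of all permutations of
`|0⟩^{⊗p} |1⟩^{⊗q}`, and a traceless (Hermitian) observable `O`. -/
structure Setup (n : ℕ) (hn : 0 < n) (d : ℕ) [NeZero d] (p q : ℕ) (τ : Str n d → ℂ)
    (O : Matrix (Fin d) (Fin d) ℂ) : Prop where
  two_le : 2 ≤ d
  add_eq : p + q = n
  schur : IsSchurVector (Composition.single n hn) τ
  mem_span : τ ∈ Submodule.span ℂ
    (Set.range fun π : Equiv.Perm (Fin n) => permOp π *ᵥ ket (stepString n d p))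
  hermitian : O.IsHermitian
  traceless : O.trace = 0

/-- The upper left `2 × 2` block of `O` is `[[1, 1], [1, -1]]`; the other entries are free. -/
def HasHadamardBlock {d : ℕ} [NeZero d] (O : Matrix (Fin d) (Fin d) ℂ) : Prop :=
  O 0 0 = 1 ∧ O 0 1 = 1 ∧ O 1 0 = 1 ∧ O 1 1 = -1

/-- The spectral norm of a matrix. -/
noncomputable def specNorm {d : ℕ} (M : Matrix (Fin d) (Fin d) ℂ) : ℝ :=
  ‖Matrix.toEuclideanCLM (n := Fin d) (𝕜 := ℂ) M‖

end QuditShadow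

namespace QuditShadow

/-! ### Moments of the first column of a Haar random unitary. -/

section HaarMoments

/-! For one row, the Young symmetrizer is the sum of all permutation operators, so `τ` is
permutation invariant. Being also supported on the strings with `p` zeros and `q` ones, it is
constant there (`Setup.eq_ite`), with squared amplitude `1 / n.choose p`. Hence "fail" has
probability zero. If `φ` is the first column of `U`, the Born density of the outcome `φφ†` is `κ_n *
n.choose p * |φ_0|^(2p) * |φ_1|^(2q)` (`Setup.trace_povmElement`). The variance is therefore a
matter of moments of `φ` under Haar measure, with exponents shifted by `p` at `0` and `q` at `1`.

These moments come from invariance alone. Diagonal phases kill every moment whose holomorphic and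
antiholomorphic exponents differ. Rotations in the plane of two coordinates compare the diagonal
moments of equal degree (`choose_mul_colMoment_pairExponent`). The relation `∑ |φ_i|² = 1` then
yields the recursion `colMoment_add_single`, in which raising `α i` by one multiplies the moment by
`(α i + 1) / (|α| + d)`, and with it the closed form `ascFactorial_mul_colMoment`.

One use of the recursion gives the mean of `tr(O ψ)` and two uses give its second moment
(`integral_expectation`, `integral_expectation_sq`); together they give the exact variance. With the
prescribed block the formula implies `p * q ≤ Var` for every `n` (`Setup.mul_le_estimateVar`). Since
`p * q` is at least `c² n²`, this gives the quadratic lower bound and beats any bound linear in `n`.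
-/

instance instIsHaarMeasureHaarUnitary (d : ℕ) : (haarUnitary d).IsHaarMeasure :=
  inferInstanceAs (Measure.haarMeasure ⊤).IsHaarMeasure

instance instIsProbabilityMeasureHaarUnitary (d : ℕ) : IsProbabilityMeasure (haarUnitary d) :=
  ⟨Measure.haarMeasure_self⟩

/-- The monomial `∏ i, φ_i ^ α i * conj φ_i ^ β i` in the entries `φ` of the first column of a
unitary matrix. -/
noncomputable def colMonomial {d : ℕ} [NeZero d] (α β : Fin d → ℕ)
    (U : Matrix.unitaryGroup (Fin d) ℂ) : ℂ :=
  ∏ i, ((U : Matrix (Fin d) (Fin d) ℂ) i 0 ^ α i * star ((U : Matrix (Fin d) (Fin d) ℂ) i 0) ^ β i)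

/-- The mixed moment of the first column of a Haar random unitary. -/
noncomputable def colMoment {d : ℕ} [NeZero d] (α β : Fin d → ℕ) : ℂ :=
  ∫ U, colMonomial α β U ∂haarUnitary d

variable {d : ℕ} [NeZero d]

omit [NeZero d] in
@[fun_prop]
theorem continuous_unitary_entry (i j : Fin d) :
    Continuous fun U : Matrix.unitaryGroup (Fin d) ℂ => (U : Matrix (Fin d) (Fin d) ℂ) i j :=
  (continuous_subtype_val).matrix_elem i j

@[fun_prop]
theorem continuous_colMonomial (α β : Fin d → ℕ) : Continuous (colMonomial α β) := by
  unfold colMonomial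
  fun_prop

omit [NeZero d] in
theorem integrable_of_continuous_unitary {E : Type*} [NormedAddCommGroup E]
    {f : Matrix.unitaryGroup (Fin d) ℂ → E} (hf : Continuous f) : Integrable f (haarUnitary d) :=
  hf.integrable_of_hasCompactSupport (HasCompactSupport.of_compactSpace f)

theorem colMonomial_add (α β α' β' : Fin d → ℕ) (U : Matrix.unitaryGroup (Fin d) ℂ) :
    colMonomial (α + α') (β + β') U = colMonomial α β U * colMonomial α' β' U := by
  simp only [colMonomial, Pi.add_apply, pow_add, ← Finset.prod_mul_distrib]
  exact Finset.prod_congr rfl fun i _ => by ring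

theorem colMonomial_single (i j : Fin d) (k l : ℕ) (U : Matrix.unitaryGroup (Fin d) ℂ) :
    colMonomial (Pi.single i k) (Pi.single j l) U =
      (U : Matrix (Fin d) (Fin d) ℂ) i 0 ^ k * star ((U : Matrix (Fin d) (Fin d) ℂ) j 0) ^ l := by
  rw [colMonomial, Finset.prod_mul_distrib]
  congr 1
  · rw [Finset.prod_eq_single i] <;> simp +contextual
  · rw [Finset.prod_eq_single j] <;> simp +contextual

theorem colMoment_zero : colMoment (0 : Fin d → ℕ) 0 = 1 := by
  simp [colMoment, colMonomial]

omit [NeZero d] in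
theorem integral_comp_mul_left (V : Matrix.unitaryGroup (Fin d) ℂ)
    (f : Matrix.unitaryGroup (Fin d) ℂ → ℂ) :
    ∫ U, f (V * U) ∂haarUnitary d = ∫ U, f U ∂haarUnitary d :=
  integral_mul_left_eq_self f V

/-- Moments whose holomorphic and antiholomorphic degrees differ vanish. -/
theorem colMoment_eq_zero_of_ne {α β : Fin d → ℕ} (h : α ≠ β) : colMoment α β = 0 := by
  obtain ⟨i, hi⟩ := Function.ne_iff.mp h
  -- With this angle, the phase `z` at coordinate `i` multiplies the monomial by `exp(iπ) = -1`, so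
  -- invariance makes the moment equal to its own negative.
  set t : ℝ := Real.pi / ((α i : ℝ) - β i)
  set z : ℂ := Complex.exp (t * Complex.I)
  have hne : (α i : ℝ) - β i ≠ 0 := sub_ne_zero.mpr (by exact_mod_cast hi)
  have hzs : star z = Complex.exp (-(t * Complex.I)) := by
    simp [z, ← Complex.exp_conj]
  have hz1 : z * star z = 1 := by rw [hzs, ← Complex.exp_add]; simp
  have hz : z ^ α i * star z ^ β i = -1 := by
    rw [hzs, ← Complex.exp_nat_mul, ← Complex.exp_nat_mul, ← Complex.exp_add,
      ← Complex.exp_pi_mul_I]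
    congr 1
    have : ((t * ((α i : ℝ) - β i) : ℝ) : ℂ) = Real.pi := by
      rw [div_mul_cancel₀ _ hne]
    push_cast at this
    rw [← this]; ring
  let D : Matrix (Fin d) (Fin d) ℂ := Matrix.diagonal (Function.update 1 i z)
  have hD : D ∈ Matrix.unitaryGroup (Fin d) ℂ := by
    rw [Matrix.mem_unitaryGroup_iff, Matrix.star_eq_conjTranspose, Matrix.diagonal_conjTranspose,
      Matrix.diagonal_mul_diagonal, ← Matrix.diagonal_one]
    congr 1
    ext j
    by_cases hj : j = i
    · subst hj; simpa using hz1
    · simp [hj]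
  have key : ∀ U, colMonomial α β ((⟨D, hD⟩ : Matrix.unitaryGroup (Fin d) ℂ) * U) =
      -colMonomial α β U := by
    intro U
    have hU : ∀ j, ((((⟨D, hD⟩ : Matrix.unitaryGroup (Fin d) ℂ) * U :
        Matrix.unitaryGroup (Fin d) ℂ)) : Matrix (Fin d) (Fin d) ℂ) j 0 =
        Function.update (1 : Fin d → ℂ) i z j * (U : Matrix (Fin d) (Fin d) ℂ) j 0 := by
      intro j
      simp [D, Matrix.diagonal_mul]
    simp only [colMonomial, hU, star_mul', mul_pow]
    have : ∀ j, Function.update (1 : Fin d → ℂ) i z j ^ α j *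
        star (Function.update (1 : Fin d → ℂ) i z j) ^ β j = if j = i then -1 else 1 := by
      intro j
      by_cases hj : j = i
      · subst hj; simpa using hz
      · simp [hj]
    calc _ = ∏ j, ((if j = i then (-1 : ℂ) else 1) * ((U : Matrix (Fin d) (Fin d) ℂ) j 0 ^ α j *
          star ((U : Matrix (Fin d) (Fin d) ℂ) j 0) ^ β j)) :=
          Finset.prod_congr rfl fun j _ => by rw [← this j]; ring
      _ = _ := by rw [Finset.prod_mul_distrib]; simp
  have := integral_comp_mul_left ⟨D, hD⟩ (colMonomial α β)
  simp only [key, integral_neg] at this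
  exact self_eq_neg.mp this.symm

/-- A column of a unitary matrix is a unit vector: inserting the factor `∑ |φ_i|² = 1` under the
integral changes nothing. -/
theorem sum_colMoment_add_single (α β : Fin d → ℕ) :
    ∑ i, colMoment (α + Pi.single i 1) (β + Pi.single i 1) = colMoment α β := by
  unfold colMoment
  rw [← integral_finsetSum _ fun i _ => integrable_of_continuous_unitary (by fun_prop)]
  congr 1
  ext U
  simp only [colMonomial_add, colMonomial_single, pow_one, ← Finset.mul_sum]
  have : ∑ i, (U : Matrix (Fin d) (Fin d) ℂ) i 0 * star ((U : Matrix (Fin d) (Fin d) ℂ) i 0) = 1 := by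
    have h := congrFun (congrFun (Matrix.mem_unitaryGroup_iff'.mp U.2) 0) 0
    simpa [Matrix.mul_apply, Matrix.star_apply, mul_comm] using h
  rw [this, mul_one]

/-- The plane rotation by the angle with cosine `c` and sine `s`, acting on the coordinates
`i` and `j`. -/
def planeRotation (i j : Fin d) (c s : ℝ) : Matrix (Fin d) (Fin d) ℂ :=
  Matrix.of fun a => if a = i then (c : ℂ) • Pi.single i 1 + (s : ℂ) • Pi.single j 1
    else if a = j then (c : ℂ) • Pi.single j 1 - (s : ℂ) • Pi.single i 1 else Pi.single a 1

omit [NeZero d] in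
theorem planeRotation_left (i j : Fin d) (c s : ℝ) :
    planeRotation i j c s i = (c : ℂ) • Pi.single i 1 + (s : ℂ) • Pi.single j 1 :=
  if_pos rfl

omit [NeZero d] in
theorem planeRotation_right {i j : Fin d} (hij : i ≠ j) (c s : ℝ) :
    planeRotation i j c s j = (c : ℂ) • Pi.single j 1 - (s : ℂ) • Pi.single i 1 :=
  (if_neg hij.symm).trans (if_pos rfl)

omit [NeZero d] in
theorem planeRotation_of_ne {i j a : Fin d} (hi : a ≠ i) (hj : a ≠ j) (c s : ℝ) :
    planeRotation i j c s a = Pi.single a 1 :=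
  (if_neg hi).trans (if_neg hj)

omit [NeZero d] in
theorem planeRotation_mem {i j : Fin d} (hij : i ≠ j) {c s : ℝ} (h : c ^ 2 + s ^ 2 = 1) :
    planeRotation i j c s ∈ Matrix.unitaryGroup (Fin d) ℂ := by
  have hc : (c : ℂ) * c + s * s = 1 := by exact_mod_cast (by linarith : c * c + s * s = 1)
  rw [Matrix.mem_unitaryGroup_iff]
  ext a b
  change planeRotation i j c s a ⬝ᵥ star (planeRotation i j c s b) = _
  have hji := hij.symm
  have hrow : ∀ a, a = i ∨ a = j ∨ (a ≠ i ∧ a ≠ j) := by tauto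
  rcases hrow a with rfl | rfl | ⟨ha, ha'⟩ <;> rcases hrow b with hb | hb | ⟨hb, hb'⟩
  case inl.inl =>
    subst hb
    rw [planeRotation_left]
    simp [hij, hji, hc]
  case inl.inr.inl =>
    subst hb
    rw [planeRotation_left, planeRotation_right hij]
    simp [hij, hji]
    ring
  case inl.inr.inr =>
    rw [planeRotation_left, planeRotation_of_ne hb hb']
    simp [hb.symm, hb'.symm]
  case inr.inl.inl =>
    subst hb
    rw [planeRotation_left, planeRotation_right hij]
    simp [hij, hji]
    ring
  case inr.inl.inr.inl =>
    subst hb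
    rw [planeRotation_right hij]
    simp [hij, hji, hc]
  case inr.inl.inr.inr =>
    rw [planeRotation_right hij, planeRotation_of_ne hb hb']
    simp [hb.symm, hb'.symm]
  case inr.inr.inl =>
    subst hb
    rw [planeRotation_left, planeRotation_of_ne ha ha']
    simp [ha, ha']
  case inr.inr.inr.inl =>
    subst hb
    rw [planeRotation_right hij, planeRotation_of_ne ha ha']
    simp [ha, ha']
  case inr.inr.inr.inr =>
    rw [planeRotation_of_ne ha ha', planeRotation_of_ne hb hb']
    simp [Matrix.one_apply, Pi.single_apply, eq_comm]

/-- The exponents that agree with `γ` off `i` and `j`, and are `a` and `b` there. -/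
def pairExponent (γ : Fin d → ℕ) (i j : Fin d) (a b : ℕ) : Fin d → ℕ :=
  Function.update (Function.update γ i a) j b

omit [NeZero d] in
theorem prod_pair_rest {i j : Fin d} (hij : i ≠ j) (f : Fin d → ℂ) :
    ∏ l, f l = f i * f j * ∏ l ∈ (Finset.univ.erase i).erase j, f l := by
  rw [mul_assoc, Finset.mul_prod_erase _ _ (by simp [hij.symm]),
    Finset.mul_prod_erase _ _ (Finset.mem_univ i)]

/-- The factor of a monomial that involves neither coordinate `i` nor `j`. -/
noncomputable def restMonomial (γ : Fin d → ℕ) (i j : Fin d)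
    (U : Matrix.unitaryGroup (Fin d) ℂ) : ℂ :=
  ∏ l ∈ (Finset.univ.erase i).erase j,
    ((U : Matrix (Fin d) (Fin d) ℂ) l 0 ^ γ l * star ((U : Matrix (Fin d) (Fin d) ℂ) l 0) ^ γ l)

@[fun_prop]
theorem continuous_restMonomial (γ : Fin d → ℕ) (i j : Fin d) :
    Continuous (restMonomial γ i j) := by
  unfold restMonomial
  fun_prop

theorem colMonomial_pairExponent (γ : Fin d → ℕ) {i j : Fin d} (hij : i ≠ j) (a b a' b' : ℕ)
    (U : Matrix.unitaryGroup (Fin d) ℂ) :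
    colMonomial (pairExponent γ i j a b) (pairExponent γ i j a' b') U =
      (U : Matrix (Fin d) (Fin d) ℂ) i 0 ^ a * (U : Matrix (Fin d) (Fin d) ℂ) j 0 ^ b *
        (star ((U : Matrix (Fin d) (Fin d) ℂ) i 0) ^ a' *
          star ((U : Matrix (Fin d) (Fin d) ℂ) j 0) ^ b') * restMonomial γ i j U := by
  rw [colMonomial, prod_pair_rest hij, restMonomial]
  congr 1
  · simp [pairExponent, hij]
    ring
  · refine Finset.prod_congr rfl fun l hl => ?_
    simp only [Finset.mem_erase, Finset.mem_univ, and_true] at hl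
    simp [pairExponent, hl.1, hl.2]

omit [NeZero d] in
theorem pairExponent_injective (γ : Fin d → ℕ) {i j : Fin d} (hij : i ≠ j) {a b a' b' : ℕ}
    (h : pairExponent γ i j a b = pairExponent γ i j a' b') : a = a' := by
  simpa [pairExponent, hij] using congrFun h i

/-- Invariance under plane rotations, with the binomial powers expanded. -/
theorem sum_choose_sq_mul_colMoment (γ : Fin d → ℕ) {i j : Fin d} (hij : i ≠ j) (k : ℕ) (t : ℝ) :
    ∑ m ∈ Finset.range (k + 1), ((k.choose m : ℂ) ^ 2 * colMoment (pairExponent γ i j m (k - m))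
        (pairExponent γ i j m (k - m))) * ((t : ℂ) ^ 2) ^ (k - m) =
      (1 + (t : ℂ) ^ 2) ^ k * colMoment (pairExponent γ i j k 0) (pairExponent γ i j k 0) := by
  -- The rotation with cosine `1/r` and sine `t/r` sends `φ_i` to `(φ_i + t φ_j)/r`. Multiplying by
  -- `r^(2k) = (1 + t²)^k` clears the root and leaves a polynomial identity in `t²`.
  set r : ℝ := Real.sqrt (1 + t ^ 2)
  have hr : r ^ 2 = 1 + t ^ 2 := Real.sq_sqrt (by positivity)
  have hr0 : r ≠ 0 := by
    intro h
    rw [h] at hr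
    nlinarith [sq_nonneg t]
  have hR := planeRotation_mem hij (c := r⁻¹) (s := t * r⁻¹)
    (by field_simp; linarith)
  set R : Matrix.unitaryGroup (Fin d) ℂ := ⟨_, hR⟩
  have hRi : ∀ U : Matrix.unitaryGroup (Fin d) ℂ, ((R * U : Matrix.unitaryGroup (Fin d) ℂ) :
      Matrix (Fin d) (Fin d) ℂ) i 0 = (r : ℂ)⁻¹ * ((U : Matrix (Fin d) (Fin d) ℂ) i 0 +
        t * (U : Matrix (Fin d) (Fin d) ℂ) j 0) := by
    intro U
    change planeRotation i j _ _ i ⬝ᵥ (fun l => (U : Matrix (Fin d) (Fin d) ℂ) l 0) = _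
    rw [planeRotation_left]
    simp [add_dotProduct]
    ring
  have hRrest : ∀ U, restMonomial γ i j (R * U) = restMonomial γ i j U := by
    intro U
    refine Finset.prod_congr rfl fun l hl => ?_
    simp only [Finset.mem_erase, Finset.mem_univ, and_true] at hl
    have : ((R * U : Matrix.unitaryGroup (Fin d) ℂ) : Matrix (Fin d) (Fin d) ℂ) l 0 =
        (U : Matrix (Fin d) (Fin d) ℂ) l 0 := by
      change planeRotation i j _ _ l ⬝ᵥ (fun l => (U : Matrix (Fin d) (Fin d) ℂ) l 0) = _
      rw [planeRotation_of_ne hl.2 hl.1]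
      simp
    rw [this]
  have hinv := integral_comp_mul_left R
    (colMonomial (pairExponent γ i j k 0) (pairExponent γ i j k 0))
  have hexp : ∀ U, (1 + (t : ℂ) ^ 2) ^ k *
      colMonomial (pairExponent γ i j k 0) (pairExponent γ i j k 0) (R * U) =
      ∑ m ∈ Finset.range (k + 1), ∑ m' ∈ Finset.range (k + 1),
        ((t : ℂ) ^ (k - m) * k.choose m * ((t : ℂ) ^ (k - m') * k.choose m')) *
          colMonomial (pairExponent γ i j m (k - m)) (pairExponent γ i j m' (k - m')) U := by
    intro U
    have hrc : (r : ℂ) ^ 2 = 1 + (t : ℂ) ^ 2 := by exact_mod_cast hr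
    have hrc0 : (r : ℂ) ≠ 0 := by exact_mod_cast hr0
    simp only [colMonomial_pairExponent γ hij, hRi, hRrest, ← hrc]
    have h1 : ∀ x y : ℂ, ((r : ℂ) ^ 2) ^ k * (((r : ℂ)⁻¹ * x) ^ k * 1 *
        (star ((r : ℂ)⁻¹ * x) ^ k * 1) * y) = x ^ k * star x ^ k * y := by
      intro x y
      have : star ((r : ℂ)⁻¹ * x) = (r : ℂ)⁻¹ * star x := by simp
      rw [this, mul_pow, mul_pow]
      have h2 : ((r : ℂ) ^ 2) ^ k * ((r : ℂ)⁻¹ ^ k * (r : ℂ)⁻¹ ^ k) = 1 := by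
        rw [← mul_pow, ← mul_pow, sq]
        field_simp
        simp
      linear_combination (x ^ k * star x ^ k * y) * h2
    rw [pow_zero, pow_zero, h1, star_add, star_mul', add_pow, add_pow, Finset.sum_mul_sum,
      Finset.sum_mul]
    refine Finset.sum_congr rfl fun m _ => ?_
    rw [Finset.sum_mul]
    refine Finset.sum_congr rfl fun m' _ => ?_
    have : star (t : ℂ) = t := by simp
    rw [this]
    ring
  rw [colMoment, ← hinv, ← integral_const_mul]
  simp only [hexp]
  rw [integral_finsetSum _ fun m _ => integrable_of_continuous_unitary (by fun_prop)]
  refine Finset.sum_congr rfl fun m hm => ?_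
  rw [integral_finsetSum _ fun m _ => integrable_of_continuous_unitary (by fun_prop),
    Finset.sum_eq_single_of_mem m hm]
  · rw [integral_const_mul, colMoment]
    ring
  -- The cross terms of the two binomial expansions have unequal exponents and vanish by phase
  -- invariance.
  · intro m' _ hne
    rw [integral_const_mul]
    have := colMoment_eq_zero_of_ne (d := d) (α := pairExponent γ i j m (k - m))
      (β := pairExponent γ i j m' (k - m')) fun h => hne (pairExponent_injective γ hij h).symm
    rw [colMoment] at this
    rw [this, mul_zero]

/-- The rotation identity holds for every real `t`, so the coefficients of `(t²)^(k-m)` agree;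
cancelling one of the two binomial factors on the left gives the claim. -/
theorem choose_mul_colMoment_pairExponent (γ : Fin d → ℕ) {i j : Fin d} (hij : i ≠ j) {k m : ℕ}
    (hm : m ≤ k) :
    (k.choose m : ℂ) * colMoment (pairExponent γ i j m (k - m)) (pairExponent γ i j m (k - m)) =
      colMoment (pairExponent γ i j k 0) (pairExponent γ i j k 0) := by
  open Polynomial in
  set f : ℕ → ℂ := fun m =>
    colMoment (pairExponent γ i j m (k - m)) (pairExponent γ i j m (k - m))
  have hpoly : (∑ m ∈ Finset.range (k + 1),
      C ((k.choose m : ℂ) ^ 2 * f m) * X ^ (k - m) : ℂ[X]) =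
      (1 + X) ^ k * C (colMoment (pairExponent γ i j k 0) (pairExponent γ i j k 0)) := by
    -- The variable `X` stands for `t²`; natural values of `t` already provide infinitely many
    -- points.
    refine Polynomial.eq_of_infinite_eval_eq _ _ (Set.Infinite.mono
      (s := Set.range fun n : ℕ => ((n : ℝ) : ℂ) ^ 2) ?_ (Set.infinite_range_of_injective ?_))
    · rintro _ ⟨n, rfl⟩
      simpa [eval_finsetSum] using sum_choose_sq_mul_colMoment γ hij k (n : ℝ)
    · intro a b hab
      have : a ^ 2 = b ^ 2 := by
        simp only at hab
        exact_mod_cast hab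
      exact Nat.pow_left_injective two_ne_zero this
  have hcoeff := congrArg (fun P => Polynomial.coeff P (k - m)) hpoly
  simp only [finsetSum_coeff, coeff_C_mul, coeff_X_pow, coeff_mul_C, coeff_one_add_X_pow] at hcoeff
  rw [Finset.sum_eq_single_of_mem m (by simpa [Nat.lt_succ_iff] using hm)] at hcoeff
  · rw [if_pos rfl, mul_one, Nat.choose_symm hm] at hcoeff
    have hne : (k.choose m : ℂ) ≠ 0 := by exact_mod_cast (Nat.choose_pos hm).ne'
    apply mul_left_cancel₀ hne
    rw [← hcoeff]
    simp only [f]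
    ring
  · intro b hb hbm
    rw [if_neg, mul_zero]
    simp at hb
    omega

omit [NeZero d] in
theorem add_single_eq_pairExponent_left (α : Fin d → ℕ) {i j : Fin d} (hij : i ≠ j) :
    α + Pi.single i 1 = pairExponent α i j (α i + 1) (α j) := by
  ext l
  by_cases hi : l = i <;> by_cases hj : l = j <;> simp_all [pairExponent]

omit [NeZero d] in
theorem add_single_eq_pairExponent_right (α : Fin d → ℕ) {i j : Fin d} (hij : i ≠ j) :
    α + Pi.single j 1 = pairExponent α i j (α i) (α j + 1) := by
  ext l
  by_cases hi : l = i <;> by_cases hj : l = j <;> simp_all [pairExponent]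

/-- Both moments have total degree `k = α i + α j + 1` in the coordinates `i, j`, so both are the
same pure moment divided by a binomial coefficient; the two coefficients are adjacent in row `k` of
Pascal's triangle. -/
theorem succ_mul_colMoment_add_single (α : Fin d → ℕ) (i j : Fin d) :
    (α j + 1 : ℂ) * colMoment (α + Pi.single i 1) (α + Pi.single i 1) =
      (α i + 1 : ℂ) * colMoment (α + Pi.single j 1) (α + Pi.single j 1) := by
  by_cases hij : i = j
  · rw [hij]
  rw [add_single_eq_pairExponent_left α hij, add_single_eq_pairExponent_right α hij]
  have h1 := choose_mul_colMoment_pairExponent α hij (k := α i + α j + 1) (m := α i + 1) (by omega)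
  have h2 := choose_mul_colMoment_pairExponent α hij (k := α i + α j + 1) (m := α i) (by omega)
  rw [show α i + α j + 1 - (α i + 1) = α j by omega] at h1
  rw [show α i + α j + 1 - α i = α j + 1 by omega, ← h1] at h2
  have h3 := Nat.choose_succ_right_eq (α i + α j + 1) (α i)
  rw [show α i + α j + 1 - α i = α j + 1 by omega] at h3
  have h3' : ((α i + α j + 1).choose (α i + 1) : ℂ) * (α i + 1) =
      (α i + α j + 1).choose (α i) * (α j + 1) := by exact_mod_cast h3
  have hne : ((α i + α j + 1).choose (α i) : ℂ) ≠ 0 := by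
    exact_mod_cast (Nat.choose_pos (by omega)).ne'
  apply mul_left_cancel₀ hne
  linear_combination (-colMoment (pairExponent α i j (α i + 1) (α j))
    (pairExponent α i j (α i + 1) (α j))) * h3' - (α i + 1 : ℂ) * h2

/-- The recursion for the diagonal moments of the first column of a Haar random unitary. -/
theorem colMoment_add_single (α : Fin d → ℕ) (i : Fin d) :
    ((∑ l, α l : ℕ) + d : ℂ) * colMoment (α + Pi.single i 1) (α + Pi.single i 1) =
      (α i + 1 : ℂ) * colMoment α α := by
  -- Summing the exchange relation over `j` turns the factors `α j + 1` into `|α| + d`.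
  rw [← sum_colMoment_add_single α α, Finset.mul_sum,
    ← Finset.sum_congr rfl fun j _ => succ_mul_colMoment_add_single α i j, ← Finset.sum_mul]
  simp [Finset.sum_add_distrib]

/-- The diagonal moments of the first column of a Haar random unitary. -/
theorem ascFactorial_mul_colMoment (α : Fin d → ℕ) :
    (d.ascFactorial (∑ l, α l) : ℂ) * colMoment α α = ∏ l, ((α l).factorial : ℂ) := by
  induction hk : ∑ l, α l generalizing α with
  | zero =>
    have : α = 0 := by
      ext l
      simpa using Finset.sum_eq_zero_iff.mp hk l
    simp [this, colMoment_zero]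
  | succ k ih =>
    obtain ⟨i, -, hi⟩ := Finset.exists_ne_zero_of_sum_ne_zero (hk.trans_ne k.succ_ne_zero)
    obtain ⟨β, rfl⟩ : ∃ β : Fin d → ℕ, α = β + Pi.single i 1 := by
      refine ⟨α - Pi.single i 1, ?_⟩
      ext l
      by_cases hl : l = i
      · subst hl
        simp
        omega
      · simp [hl]
    have hβ : ∑ l, β l = k := by
      simpa [Finset.sum_add_distrib] using hk
    have h1 := ih β hβ
    have h2 := colMoment_add_single β i
    rw [hβ] at h2
    have h3 : ∏ l, (((β + Pi.single i 1 : Fin d → ℕ) l).factorial : ℂ) =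
        (β i + 1) * ∏ l, ((β l).factorial : ℂ) := by
      rw [← Finset.mul_prod_erase _ _ (Finset.mem_univ i),
        ← Finset.mul_prod_erase _ (fun l => ((β l).factorial : ℂ)) (Finset.mem_univ i)]
      rw [Finset.prod_congr rfl (g := fun l => ((β l).factorial : ℂ))]
      · simp [Nat.factorial_succ]
        ring
      · intro l hl
        simp [Finset.ne_of_mem_erase hl]
    rw [h3, ← h1, Nat.ascFactorial_succ]
    push_cast
    linear_combination (d.ascFactorial k : ℂ) * h2

end HaarMoments

/-! ### The state `τ` for a single row, and its Born density. -/

section SchurStates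

variable {n d : ℕ}

instance instUniqueSingleLength (hn : 0 < n) : Unique (Fin (Composition.single n hn).length) :=
  inferInstanceAs (Unique (Fin 1))

theorem rowPerms_single (hn : 0 < n) : rowPerms (Composition.single n hn) = Finset.univ :=
  Finset.filter_true_of_mem fun _ _ _ => Subsingleton.elim _ _

/-- In a single row each column has only one box, so no signs enter the Young symmetrizer. -/
theorem colPerms_single (hn : 0 < n) : colPerms (Composition.single n hn) = {1} := by
  ext π
  simp only [colPerms, Finset.mem_filter, Finset.mem_univ, true_and, Finset.mem_singleton]
  constructor
  · intro h
    ext s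
    have h1 := (Composition.single n hn).embedding_comp_inv (π s)
    have h2 := (Composition.single n hn).embedding_comp_inv s
    -- The two row indices are kept general because the types of `x` and `y` depend on them; they
    -- can then be identified by `Subsingleton.elim`.
    have h3 : ∀ (i j : Fin (Composition.single n hn).length)
        (x : Fin ((Composition.single n hn).blocksFun i))
        (y : Fin ((Composition.single n hn).blocksFun j)), (x : ℕ) = y →
        (Composition.single n hn).embedding i x = (Composition.single n hn).embedding j y := by
      intro i j x y hxy
      obtain rfl : i = j := Subsingleton.elim _ _
      rw [Fin.ext hxy]
    rw [← h1, ← h2, Equiv.Perm.one_apply, h2]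
    exact congrArg _ ((h3 _ _ _ _ (h s)).trans h2)
  · rintro rfl s
    rfl

theorem permOp_mulVec (π : Equiv.Perm (Fin n)) (v : Str n d → ℂ) (b : Str n d) :
    (permOp π *ᵥ v) b = v (b ∘ π) := by
  have h : ∀ a : Str n d, b = a ∘ ⇑π⁻¹ ↔ a = b ∘ π := by
    intro a
    constructor <;> rintro rfl <;> ext s <;> simp
  simp only [Matrix.mulVec, dotProduct, permOp, Matrix.of_apply, h]
  simp

theorem youngSymmetrizer_single_mulVec (hn : 0 < n) (v : Str n d → ℂ) (b : Str n d) :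
    (youngSymmetrizer d (Composition.single n hn) *ᵥ v) b =
      ∑ π : Equiv.Perm (Fin n), v (b ∘ π) := by
  have h1 : permOp (n := n) (d := d) 1 = 1 := by
    ext a b
    simp [permOp, Matrix.one_apply]
  simp [youngSymmetrizer, rowPerms_single, colPerms_single, h1, Matrix.sum_mulVec, permOp_mulVec]

/-- The strings with `p` zeros and otherwise ones. -/
def stepOrbit (n d p : ℕ) [NeZero d] : Finset (Str n d) :=
  Finset.univ.image fun π : Equiv.Perm (Fin n) => stepString n d p ∘ π

theorem comp_mem_stepOrbit [NeZero d] {p : ℕ} (π : Equiv.Perm (Fin n)) :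
    stepString n d p ∘ π ∈ stepOrbit n d p :=
  Finset.mem_image_of_mem _ (Finset.mem_univ π)

/-- The numeral `1` in `Fin d` wraps around to `0` when `d = 1`; here `2 ≤ d` is what separates the
two symbols. -/
theorem zero_ne_one_of_two_le [NeZero d] (hd : 2 ≤ d) : (0 : Fin d) ≠ 1 := by
  obtain ⟨k, rfl⟩ := Nat.exists_eq_add_of_le' hd
  simp

theorem card_filter_lt {p : ℕ} (hp : p ≤ n) :
    (Finset.univ.filter fun s : Fin n => (s : ℕ) < p).card = p := by
  simp [Fin.card_filter_val_lt, hp]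

/-- A string in the orbit is determined by its set of zeros. Conversely, any bijection from a
`p`-element set of positions onto the first `p` positions extends to a permutation. -/
theorem card_stepOrbit [NeZero d] (hd : 2 ≤ d) {p : ℕ} (hp : p ≤ n) :
    (stepOrbit n d p).card = n.choose p := by
  have h01 := zero_ne_one_of_two_le hd
  set f : Finset (Fin n) → Str n d := fun S s => if s ∈ S then 0 else 1
  have hf : Function.Injective f := by
    intro S T h
    ext s
    have hs := congrFun h s
    by_cases h1 : s ∈ S <;> by_cases h2 : s ∈ T <;> simp_all [f]
  have : stepOrbit n d p = ((Finset.univ : Finset (Fin n)).powersetCard p).image f := by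
    ext a
    simp only [stepOrbit, Finset.mem_image, Finset.mem_univ, true_and, Finset.mem_powersetCard,
      Finset.subset_univ]
    constructor
    · rintro ⟨π, rfl⟩
      refine ⟨(Finset.univ.filter fun s : Fin n => (s : ℕ) < p).map π.symm.toEmbedding, ?_, ?_⟩
      · rw [Finset.card_map, card_filter_lt hp]
      · ext s
        simp [f, stepString, Finset.mem_map_equiv]
    · rintro ⟨S, hS, rfl⟩
      have hcard : Fintype.card {s // s ∈ S} = Fintype.card {s : Fin n // (s : ℕ) < p} := by
        rw [Fintype.card_coe, hS, Fintype.card_subtype, card_filter_lt hp]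
      let e := Fintype.equivOfCardEq hcard
      refine ⟨e.extendSubtype, ?_⟩
      ext s
      by_cases hs : s ∈ S
      · have := e.extendSubtype_mem s hs
        simp [f, stepString, hs, this]
      · have := e.extendSubtype_not_mem s hs
        simp [f, stepString, hs, this]
  rw [this, Finset.card_image_of_injective _ hf, Finset.card_powersetCard, Finset.card_univ,
    Fintype.card_fin]

/-- A symmetric vector in the span of the permutations of a step string is a multiple of the
indicator function of its orbit. -/
theorem Setup.eq_ite [NeZero d] {hn : 0 < n} {p q : ℕ} {τ : Str n d → ℂ}
    {O : Matrix (Fin d) (Fin d) ℂ} (h : Setup n hn d p q τ O) (a : Str n d) :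
    τ a = if a ∈ stepOrbit n d p then τ (stepString n d p) else 0 := by
  split_ifs with ha
  · obtain ⟨π, -, rfl⟩ := Finset.mem_image.mp ha
    obtain ⟨⟨w, v, -, rfl⟩, -⟩ := h.schur
    rw [youngSymmetrizer_single_mulVec, youngSymmetrizer_single_mulVec]
    -- Left translation of `S_n` absorbs `π`, so a vector in the range of the symmetrizer is
    -- constant on orbits.
    exact Fintype.sum_equiv (Equiv.mulLeft π) _ _ fun σ => rfl
  · refine Submodule.span_induction (p := fun v _ => v a = 0) ?_ rfl ?_ ?_ h.mem_span
    · rintro _ ⟨π, rfl⟩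
      beta_reduce
      rw [permOp_mulVec, ket, Pi.single_eq_of_ne]
      intro hπ
      refine ha ?_
      have : a = stepString n d p ∘ ⇑π⁻¹ := by
        rw [← hπ]
        ext s
        simp
      rw [this]
      exact comp_mem_stepOrbit _
    · intro x y _ _ hx hy
      simp [hx, hy]
    · intro c x _ hx
      simp [hx]

theorem Setup.card_mul [NeZero d] {hn : 0 < n} {p q : ℕ} {τ : Str n d → ℂ}
    {O : Matrix (Fin d) (Fin d) ℂ} (h : Setup n hn d p q τ O) :
    ((stepOrbit n d p).card : ℂ) *
      (τ (stepString n d p) * star (τ (stepString n d p))) = 1 := by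
  rw [← h.schur.2, dotProduct]
  have : ∀ a, star τ a * τ a = if a ∈ stepOrbit n d p then
      τ (stepString n d p) * star (τ (stepString n d p)) else 0 := by
    intro a
    rw [Pi.star_apply, h.eq_ite a]
    split_ifs <;> simp [mul_comm]
  simp only [this]
  simp

theorem rotatedState_apply [NeZero d] (U : Matrix.unitaryGroup (Fin d) ℂ) (i j : Fin d) :
    rotatedState d U i j =
      (U : Matrix (Fin d) (Fin d) ℂ) i 0 * star ((U : Matrix (Fin d) (Fin d) ℂ) j 0) := by
  simp [rotatedState, Matrix.mul_apply, Matrix.single_apply, ite_and]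

/-- The exponents `p` at `0` and `q` at `1`. -/
def stepExponent (d p q : ℕ) [NeZero d] : Fin d → ℕ := Pi.single 0 p + Pi.single 1 q

theorem prod_comp_of_mem_stepOrbit [NeZero d] {p q : ℕ} (hpq : p + q = n) {a : Str n d}
    (ha : a ∈ stepOrbit n d p) (f : Fin d → ℂ) : ∏ s, f (a s) = f 0 ^ p * f 1 ^ q := by
  obtain ⟨π, -, rfl⟩ := Finset.mem_image.mp ha
  simp only [Function.comp_apply]
  rw [Equiv.prod_comp π fun s => f (stepString n d p s)]
  have : ∀ s, f (stepString n d p s) = if (s : ℕ) < p then f 0 else f 1 := by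
    intro s
    rw [stepString]
    split_ifs <;> rfl
  simp only [this]
  rw [Finset.prod_ite, Finset.prod_const, Finset.prod_const, Finset.filter_not,
    Finset.card_sdiff_of_subset (Finset.filter_subset _ _), card_filter_lt (by omega),
    Finset.card_univ, Fintype.card_fin, show n - p = q by omega]

/-- The Born density of the outcome `U |0⟩⟨0| U†`. -/
theorem Setup.trace_povmElement [NeZero d] {hn : 0 < n} {p q : ℕ} {τ : Str n d → ℂ}
    {O : Matrix (Fin d) (Fin d) ℂ} (h : Setup n hn d p q τ O)
    (U : Matrix.unitaryGroup (Fin d) ℂ) :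
    (povmElement (Composition.single n hn) (fun _ => rotatedState d U) * pureState τ).trace =
      (symDim d n * n.choose p : ℕ) *
        colMonomial (stepExponent d p q) (stepExponent d p q) U := by
  set z := τ (stepString n d p)
  set x := (U : Matrix (Fin d) (Fin d) ℂ) 0 0 ^ p * (U : Matrix (Fin d) (Fin d) ℂ) 1 0 ^ q
  have hmono : colMonomial (stepExponent d p q) (stepExponent d p q) U = x * star x := by
    rw [stepExponent, colMonomial_add, colMonomial_single, colMonomial_single]
    simp only [x, star_mul', star_pow]
    ring
  -- As `ψ = φφ†` has rank one, each summand of the trace splits into a function of `a` times a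
  -- function of `b`. The double sum becomes `κ_n * card² * |x|² * |z|²`, and the normalization
  -- `card * |z|² = 1` removes one factor `card`.
  have hterm : ∀ a b : Str n d,
      povmElement (Composition.single n hn) (fun _ => rotatedState d U) a b * pureState τ b a =
        symDim d n * ((if a ∈ stepOrbit n d p then x * star z else 0) *
          (if b ∈ stepOrbit n d p then star x * z else 0)) := by
    intro a b
    rw [pureState, Matrix.vecMulVec_apply, Pi.star_apply, h.eq_ite a, h.eq_ite b]
    by_cases ha : a ∈ stepOrbit n d p
    · by_cases hb : b ∈ stepOrbit n d p
      · have h1 : (∏ i, (symDim d ((Composition.single n hn).blocksFun i) : ℂ)) = symDim d n := by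
          rw [Fintype.prod_unique]
          rfl
        simp only [povmElement, Matrix.of_apply, h1, rotatedState_apply, Finset.prod_mul_distrib,
          if_pos ha, if_pos hb,
          prod_comp_of_mem_stepOrbit h.add_eq ha fun i => (U : Matrix (Fin d) (Fin d) ℂ) i 0,
          prod_comp_of_mem_stepOrbit h.add_eq hb
            fun i => star ((U : Matrix (Fin d) (Fin d) ℂ) i 0)]
        simp only [x, star_mul', star_pow]
        ring
      · simp [hb]
    · simp [ha]
  have hp : p ≤ n := by have := h.add_eq; omega
  have hc := h.card_mul
  rw [card_stepOrbit h.two_le hp] at hc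
  rw [Matrix.trace]
  simp only [Matrix.diag_apply, Matrix.mul_apply, hterm, ← Finset.mul_sum, ← Finset.sum_mul]
  simp only [Finset.sum_ite_mem, Finset.univ_inter, Finset.sum_const, nsmul_eq_mul,
    card_stepOrbit h.two_le hp, hmono]
  push_cast
  linear_combination (symDim d n * n.choose p * x * star x : ℂ) * hc

theorem Setup.trace_fail [NeZero d] {hn : 0 < n} {p q : ℕ} {τ : Str n d → ℂ}
    {O : Matrix (Fin d) (Fin d) ℂ} (h : Setup n hn d p q τ O) :
    ((1 - rowSymProj d (Composition.single n hn)) * pureState τ).trace = 0 := by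
  have hsymm : ∀ π : Equiv.Perm (Fin n), permOp π *ᵥ τ = τ := by
    intro π
    ext a
    obtain ⟨⟨w, v, -, rfl⟩, -⟩ := h.schur
    rw [permOp_mulVec, youngSymmetrizer_single_mulVec, youngSymmetrizer_single_mulVec]
    exact Fintype.sum_equiv (Equiv.mulLeft π) _ _ fun σ => rfl
  have : rowSymProj d (Composition.single n hn) *ᵥ τ = τ := by
    rw [rowSymProj, rowPerms_single, Matrix.smul_mulVec, Matrix.sum_mulVec]
    simp only [hsymm, Finset.sum_const, ← Nat.cast_smul_eq_nsmul ℂ]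
    rw [inv_smul_smul₀]
    simp [Fintype.card_perm, Nat.factorial_ne_zero]
  rw [pureState, Matrix.mul_vecMulVec, Matrix.sub_mulVec, this, Matrix.one_mulVec, sub_self]
  simp

/-- In every dimension at least two there are states as in the setup. -/
theorem exists_setup [NeZero d] (hn : 0 < n) (hd : 2 ≤ d) {p q : ℕ} (hpq : p + q = n)
    {O : Matrix (Fin d) (Fin d) ℂ} (hO : O.IsHermitian) (htr : O.trace = 0) :
    ∃ τ, Setup n hn d p q τ O := by
  set Y := youngSymmetrizer d (Composition.single n hn)
  set v : Str n d → ℂ := ket (stepString n d p)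
  have hYv : ∀ b, (Y *ᵥ v) b = (Finset.univ.filter
      fun π : Equiv.Perm (Fin n) => b ∘ π = stepString n d p).card := by
    intro b
    simp [Y, v, youngSymmetrizer_single_mulVec, ket, Pi.single_apply]
  -- This is the squared norm of `Y v`; it is positive because the identity permutation contributes
  -- at the step string itself.
  set N : ℝ := ∑ b, ((Finset.univ.filter
      fun π : Equiv.Perm (Fin n) => b ∘ π = stepString n d p).card : ℝ) ^ 2
  have hN : 0 < N := by
    refine Finset.sum_pos' (fun _ _ => by positivity) ⟨stepString n d p, Finset.mem_univ _, ?_⟩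
    have : 0 < (Finset.univ.filter
        fun π : Equiv.Perm (Fin n) => stepString n d p ∘ π = stepString n d p).card :=
      Finset.card_pos.mpr ⟨1, by simp⟩
    positivity
  set r : ℂ := (((Real.sqrt N)⁻¹ : ℝ) : ℂ)
  have hr : r * r * N = 1 := by
    have : (Real.sqrt N)⁻¹ * (Real.sqrt N)⁻¹ * N = 1 := by
      rw [← mul_inv, Real.mul_self_sqrt hN.le, inv_mul_cancel₀ hN.ne']
    simp only [r]
    exact_mod_cast this
  refine ⟨Y *ᵥ (r • v), hd, hpq, ⟨⟨weight (stepString n d p), r • v,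
    Submodule.smul_mem _ _ (Submodule.subset_span ⟨_, rfl, rfl⟩), rfl⟩, ?_⟩, ?_, hO, htr⟩
  · rw [Matrix.mulVec_smul, star_smul, smul_dotProduct, dotProduct_smul, smul_smul]
    have hrs : star r = r := by simp [r]
    have : star (Y *ᵥ v) ⬝ᵥ (Y *ᵥ v) = N := by
      simp [dotProduct, hYv, N, sq]
    rw [this, hrs, smul_eq_mul, hr]
  · have : Y = ∑ π : Equiv.Perm (Fin n), permOp π := by
      refine Matrix.ext_of_mulVec_single fun a => ?_
      ext b
      simp only [Y]
      rw [youngSymmetrizer_single_mulVec, Matrix.sum_mulVec, Finset.sum_apply]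
      simp only [permOp_mulVec]
    rw [this, Matrix.mulVec_smul, Matrix.sum_mulVec]
    exact Submodule.smul_mem _ _ (Submodule.sum_mem _ fun π _ => Submodule.subset_span ⟨π, rfl⟩)

end SchurStates

/-! ### The outcome law as the image of a law on the unitary group. -/

section OutcomeLaw

variable {n d : ℕ} [NeZero d]

theorem colMonomial_self (α : Fin d → ℕ) (U : Matrix.unitaryGroup (Fin d) ℂ) :
    colMonomial α α U =
      ((∏ i, Complex.normSq ((U : Matrix (Fin d) (Fin d) ℂ) i 0) ^ α i : ℝ) : ℂ) := by
  push_cast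
  refine Finset.prod_congr rfl fun i _ => ?_
  rw [← mul_pow, ← Complex.mul_conj]
  rfl

theorem colMonomial_self_re (α : Fin d → ℕ) (U : Matrix.unitaryGroup (Fin d) ℂ) :
    ((colMonomial α α U).re : ℂ) = colMonomial α α U := by
  rw [colMonomial_self, Complex.ofReal_re]

theorem colMonomial_self_re_nonneg (α : Fin d → ℕ) (U : Matrix.unitaryGroup (Fin d) ℂ) :
    0 ≤ (colMonomial α α U).re := by
  rw [colMonomial_self, Complex.ofReal_re]
  exact Finset.prod_nonneg fun i _ => pow_nonneg (Complex.normSq_nonneg _) _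

/-- The density, with respect to the Haar measure, of the unitary that yields the outcome. -/
noncomputable def bornDensity (d p q : ℕ) [NeZero d] (U : Matrix.unitaryGroup (Fin d) ℂ) : ℝ :=
  (symDim d (p + q) * (p + q).choose p : ℕ) *
    (colMonomial (stepExponent d p q) (stepExponent d p q) U).re

theorem bornDensity_nonneg (p q : ℕ) (U : Matrix.unitaryGroup (Fin d) ℂ) :
    0 ≤ bornDensity d p q U :=
  mul_nonneg (Nat.cast_nonneg _) (colMonomial_self_re_nonneg _ _)

@[fun_prop]
theorem continuous_bornDensity (p q : ℕ) : Continuous (bornDensity d p q) := by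
  unfold bornDensity
  exact continuous_const.mul (Complex.continuous_re.comp (by fun_prop))

/-- The law of the unitary that yields the outcome. -/
noncomputable def bornLaw (d p q : ℕ) [NeZero d] : Measure (Matrix.unitaryGroup (Fin d) ℂ) :=
  (haarUnitary d).withDensity fun U => ENNReal.ofReal (bornDensity d p q U)

theorem integral_bornLaw {E : Type*} [NormedAddCommGroup E] [NormedSpace ℝ E] (p q : ℕ)
    (f : Matrix.unitaryGroup (Fin d) ℂ → E) :
    ∫ U, f U ∂bornLaw d p q = ∫ U, bornDensity d p q U • f U ∂haarUnitary d := by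
  rw [bornLaw, integral_withDensity_eq_integral_toReal_smul (by fun_prop)
    (ae_of_all _ fun _ => ENNReal.ofReal_lt_top)]
  simp only [ENNReal.toReal_ofReal (bornDensity_nonneg p q _)]

theorem integral_bornLaw_complex (p q : ℕ) (f : Matrix.unitaryGroup (Fin d) ℂ → ℂ) :
    ∫ U, f U ∂bornLaw d p q = (symDim d (p + q) * (p + q).choose p : ℕ) *
      ∫ U, colMonomial (stepExponent d p q) (stepExponent d p q) U * f U ∂haarUnitary d := by
  rw [integral_bornLaw, ← integral_const_mul]
  congr 1
  ext U
  rw [Complex.real_smul, bornDensity, Complex.ofReal_mul, colMonomial_self_re,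
    Complex.ofReal_natCast, mul_assoc]

/-- The Born density is itself a diagonal monomial up to a constant, so weighting by it merely
shifts the exponents. -/
theorem integral_bornLaw_colMonomial (p q : ℕ) (α β : Fin d → ℕ) :
    ∫ U, colMonomial α β U ∂bornLaw d p q = (symDim d (p + q) * (p + q).choose p : ℕ) *
      colMoment (stepExponent d p q + α) (stepExponent d p q + β) := by
  rw [integral_bornLaw_complex, colMoment]
  simp only [colMonomial_add]

theorem stepExponent_zero (hd : 2 ≤ d) (p q : ℕ) : stepExponent d p q 0 = p := by
  simp [stepExponent, zero_ne_one_of_two_le hd]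

theorem stepExponent_one (hd : 2 ≤ d) (p q : ℕ) : stepExponent d p q 1 = q := by
  simp [stepExponent, (zero_ne_one_of_two_le hd).symm]

theorem sum_stepExponent (p q : ℕ) : ∑ l, stepExponent d p q l = p + q := by
  simp [stepExponent, Finset.sum_add_distrib]

theorem sum_mul_stepExponent (p q : ℕ) (f : Fin d → ℂ) :
    ∑ l, f l * stepExponent d p q l = p * f 0 + q * f 1 := by
  simp [stepExponent, mul_add, Finset.sum_add_distrib, Pi.single_apply, mul_comm]

theorem prod_factorial_stepExponent (hd : 2 ≤ d) (p q : ℕ) :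
    ∏ l, ((stepExponent d p q l).factorial : ℂ) = p.factorial * q.factorial := by
  rw [prod_pair_rest (zero_ne_one_of_two_le hd), stepExponent_zero hd, stepExponent_one hd,
    Finset.prod_eq_one, mul_one]
  intro l hl
  simp only [Finset.mem_erase, Finset.mem_univ, and_true] at hl
  simp [stepExponent, hl.1, hl.2]

/-- The normalization of the Born rule. -/
theorem norm_mul_colMoment_stepExponent (hd : 2 ≤ d) (p q : ℕ) :
    (symDim d (p + q) * (p + q).choose p : ℕ) *
      colMoment (stepExponent d p q) (stepExponent d p q) = 1 := by
  have h1 := ascFactorial_mul_colMoment (stepExponent d p q)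
  rw [sum_stepExponent, prod_factorial_stepExponent hd] at h1
  -- The denominator of the Haar moment is `n! κ_n`, which cancels against the POVM constant and the
  -- binomial coefficient.
  have h2 : d.ascFactorial (p + q) = (p + q).factorial * symDim d (p + q) := by
    obtain ⟨k, rfl⟩ := Nat.exists_eq_add_of_le' (show 1 ≤ d by omega)
    rw [Nat.ascFactorial_eq_factorial_mul_choose, symDim, Nat.add_sub_cancel,
      show p + q + (k + 1) - 1 = k + (p + q) by omega, Nat.choose_symm_add]
  have h3 := Nat.add_choose_mul_factorial_mul_factorial p q
  rw [← Nat.choose_symm_add] at h3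
  have hne : ((p.factorial * q.factorial : ℕ) : ℂ) ≠ 0 := by
    exact_mod_cast (Nat.mul_pos p.factorial_pos q.factorial_pos).ne'
  apply mul_left_cancel₀ hne
  rw [h2, ← h3] at h1
  push_cast at h1 ⊢
  linear_combination h1

theorem isProbabilityMeasure_bornLaw (hd : 2 ≤ d) (p q : ℕ) :
    IsProbabilityMeasure (bornLaw d p q) := by
  have h : ∫ U, bornDensity d p q U ∂haarUnitary d = 1 := by
    apply Complex.ofReal_injective
    rw [← integral_complex_ofReal, Complex.ofReal_one, ← norm_mul_colMoment_stepExponent hd p q,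
      colMoment, ← integral_const_mul]
    congr 1
    ext U
    rw [bornDensity, Complex.ofReal_mul, colMonomial_self_re, Complex.ofReal_natCast]
  refine ⟨?_⟩
  rw [bornLaw, withDensity_apply _ MeasurableSet.univ, Measure.restrict_univ,
    ← ofReal_integral_eq_lintegral_ofReal (integrable_of_continuous_unitary (by fun_prop))
      (ae_of_all _ (bornDensity_nonneg p q)), h, ENNReal.ofReal_one]

@[fun_prop]
theorem measurable_rotatedState : Measurable (rotatedState d) := by
  refine Continuous.measurable ?_
  refine continuous_matrix fun i j => ?_
  simp only [rotatedState_apply]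
  fun_prop

/-- This pulls the Born density back from states to unitaries, where the functions to integrate are
continuous on a compact group. -/
theorem map_withDensity_comp {X Y : Type*} [MeasurableSpace X] [MeasurableSpace Y]
    (μ : Measure X) {f : X → Y} (hf : Measurable f) {g : Y → ENNReal} (hg : Measurable g) :
    (μ.map f).withDensity g = (μ.withDensity (g ∘ f)).map f := by
  ext s hs
  rw [withDensity_apply _ hs, Measure.map_apply hf hs, withDensity_apply _ (hf hs),
    setLIntegral_map hs hg hf]
  rfl

theorem pi_haarState_single (hn : 0 < n) :
    Measure.pi (fun _ : Fin (Composition.single n hn).length => haarState d) =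
      (haarUnitary d).map fun U _ => rotatedState d U := by
  have h := (measurePreserving_funUnique (haarState d)
    (Fin (Composition.single n hn).length)).symm.map_eq
  have h' : Measure.pi (fun _ : Fin (Composition.single n hn).length => haarState d) =
      (haarState d).map (MeasurableEquiv.funUnique (Fin (Composition.single n hn).length)
        (Matrix (Fin d) (Fin d) ℂ)).symm := by
    rw [h]
    convert rfl
  rw [h', haarState, Measure.map_map (MeasurableEquiv.measurable _) measurable_rotatedState]
  rfl

omit [NeZero d] in
theorem measurable_matrix_apply {ι : Type*} (k : ι) (i j : Fin d) :
    Measurable fun ψ : ι → Matrix (Fin d) (Fin d) ℂ => ψ k i j :=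
  (measurable_pi_apply j).comp ((measurable_pi_apply i).comp (measurable_pi_apply k))

omit [NeZero d] in
theorem measurable_trace_povmElement (lam : Composition n) (ρ : Matrix (Str n d) (Str n d) ℂ) :
    Measurable fun ψ => ENNReal.ofReal (povmElement lam ψ * ρ).trace.re := by
  refine (Complex.measurable_re.comp ?_).ennreal_ofReal
  simp only [Matrix.trace, Matrix.diag_apply, Matrix.mul_apply, povmElement, Matrix.of_apply]
  refine Finset.measurable_sum _ fun a _ => Finset.measurable_sum _ fun b _ => ?_
  refine ((Finset.measurable_prod _ fun s _ => ?_).const_mul _).mul_const _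
  exact measurable_matrix_apply _ _ _

/-- The outcome is distributed like `U |0⟩⟨0| U†` for `U` with law `bornLaw d p q`. -/
theorem Setup.outcomeLaw_eq {hn : 0 < n} {p q : ℕ} {τ : Str n d → ℂ}
    {O : Matrix (Fin d) (Fin d) ℂ} (h : Setup n hn d p q τ O) :
    outcomeLaw d (Composition.single n hn) (pureState τ) =
      (bornLaw d p q).map fun U => Sum.inl fun _ => rotatedState d U := by
  have hf : Measurable fun (U : Matrix.unitaryGroup (Fin d) ℂ)
      (_ : Fin (Composition.single n hn).length) => rotatedState d U :=
    measurable_pi_lambda _ fun _ => measurable_rotatedState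
  rw [outcomeLaw, h.trace_fail, pi_haarState_single,
    map_withDensity_comp _ hf (measurable_trace_povmElement _ _), Measure.map_map measurable_inl hf]
  simp only [Complex.zero_re, ENNReal.ofReal_zero, zero_smul, add_zero]
  have : (fun ψ => ENNReal.ofReal (povmElement (Composition.single n hn) ψ * pureState τ).trace.re) ∘
      (fun (U : Matrix.unitaryGroup (Fin d) ℂ) _ => rotatedState d U) =
      fun U => ENNReal.ofReal (bornDensity d p q U) := by
    ext U
    rw [Function.comp_apply, h.trace_povmElement, bornDensity, ← colMonomial_self_re, h.add_eq,
      ← Complex.ofReal_natCast, ← Complex.ofReal_mul, Complex.ofReal_re, Complex.ofReal_re]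
  rw [this]
  rfl

omit [NeZero d] in
theorem measurable_estimate (lam : Composition n) (O : Matrix (Fin d) (Fin d) ℂ) :
    Measurable (estimate lam O) := by
  refine measurable_fun_sum ?_ (measurable_of_finite _)
  refine Complex.measurable_re.comp ?_
  simp only [shadow, Matrix.trace, Matrix.diag_apply, Matrix.mul_apply, Matrix.sum_apply,
    Matrix.smul_apply, smul_eq_mul]
  refine Finset.measurable_sum _ fun a _ => Finset.measurable_sum _ fun b _ => ?_
  refine (Finset.measurable_sum _ fun i _ => ?_).const_mul _
  exact (measurable_matrix_apply _ _ _).const_mul _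

end OutcomeLaw

/-! ### First and second moments of the estimate, and the variance. -/

section Variance

variable {n d : ℕ} [NeZero d]

/-- The one-step recursion is used twice; the extra `1` for `m = i` appears because the first step
has already raised that exponent. -/
theorem colMoment_add_single_single (α : Fin d → ℕ) (i m : Fin d) :
    ((∑ l, α l : ℕ) + d : ℂ) * ((∑ l, α l : ℕ) + d + 1) *
      colMoment (α + (Pi.single i 1 + Pi.single m 1)) (α + (Pi.single i 1 + Pi.single m 1)) =
      (α i + 1) * (α m + 1 + if m = i then 1 else 0) * colMoment α α := by
  have h1 := colMoment_add_single α i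
  have h2 := colMoment_add_single (α + Pi.single i 1) m
  have hs : ∑ l, (α + Pi.single i 1 : Fin d → ℕ) l = ∑ l, α l + 1 := by
    simp [Finset.sum_add_distrib]
  rw [hs] at h2
  have hm : (((α + Pi.single i 1 : Fin d → ℕ) m : ℕ) : ℂ) = α m + if m = i then 1 else 0 := by
    simp [Pi.single_apply]
  rw [hm] at h2
  rw [← add_assoc]
  push_cast at h1 h2 ⊢
  linear_combination (∑ l, (α l : ℂ) + d) * h2 + (α m + 1 + if m = i then 1 else 0) * h1

omit [NeZero d] in
theorem single_add_single_eq_iff {i j l m : Fin d} :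
    (Pi.single j 1 + Pi.single l 1 : Fin d → ℕ) = Pi.single i 1 + Pi.single m 1 ↔
      (j = i ∧ l = m) ∨ (l = i ∧ j = m) := by
  constructor
  · intro h
    by_cases hj : j = i
    · subst hj
      have h' := congrFun (add_left_cancel h) l
      refine Or.inl ⟨rfl, ?_⟩
      by_contra hne
      simp [hne] at h'
    · have h1 := congrFun h i
      by_cases hl : l = i
      · subst hl
        rw [add_comm] at h
        have h' := congrFun (add_left_cancel h) j
        refine Or.inr ⟨rfl, ?_⟩
        by_contra hne
        simp [hne] at h'
      · simp [Ne.symm hj, Ne.symm hl] at h1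
        omega
  · rintro (⟨rfl, rfl⟩ | ⟨rfl, rfl⟩)
    · rfl
    · rw [add_comm]

/-- The moments of the first column of a Haar random unitary that have bidegree `(2, 2)` over a
diagonal one. -/
theorem colMoment_bidegree_two (α : Fin d → ℕ) (i j m l : Fin d) :
    ((∑ l, α l : ℕ) + d : ℂ) * ((∑ l, α l : ℕ) + d + 1) *
      colMoment (α + (Pi.single j 1 + Pi.single l 1)) (α + (Pi.single i 1 + Pi.single m 1)) =
      ((if j = i then if l = m then ((α i : ℂ) + 1) * (α m + 1) else 0 else 0) +
        (if l = i then if j = m then ((α i : ℂ) + 1) * (α m + 1) else 0 else 0) -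
        (if j = i then if l = m then if m = i then ((α i : ℂ) + 1) * α i else 0 else 0 else 0)) *
        colMoment α α := by
  -- A nonzero moment requires the index pairs `{j, l}` and `{i, m}` to match, in one of two ways.
  -- When all four indices coincide both matchings count, giving `2(a+1)²` in place of `(a+1)(a+2)`;
  -- the third term subtracts the excess `(a+1)a`.
  by_cases h : (Pi.single j 1 + Pi.single l 1 : Fin d → ℕ) = Pi.single i 1 + Pi.single m 1
  · rw [h, colMoment_add_single_single]
    rcases single_add_single_eq_iff.mp h with ⟨rfl, rfl⟩ | ⟨rfl, rfl⟩
    · by_cases hl : l = j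
      · subst hl
        simp only [↓reduceIte]
        ring
      · simp [hl]
    · by_cases hl : l = j
      · subst hl
        simp only [↓reduceIte]
        ring
      · simp [Ne.symm hl]
  · rw [colMoment_eq_zero_of_ne fun h' => h (add_left_cancel h'), mul_zero]
    rw [single_add_single_eq_iff, not_or, not_and, not_and] at h
    by_cases hj : j = i <;> by_cases hl : l = i <;> simp_all

/-- The complex number `tr(O U |0⟩⟨0| U†)`. -/
noncomputable def expectation (O : Matrix (Fin d) (Fin d) ℂ)
    (U : Matrix.unitaryGroup (Fin d) ℂ) : ℂ :=
  (O * rotatedState d U).trace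

theorem expectation_eq_sum (O : Matrix (Fin d) (Fin d) ℂ) (U : Matrix.unitaryGroup (Fin d) ℂ) :
    expectation O U = ∑ i, ∑ j, O i j * colMonomial (Pi.single j 1) (Pi.single i 1) U := by
  simp only [expectation, Matrix.trace, Matrix.diag_apply, Matrix.mul_apply, rotatedState_apply,
    colMonomial_single, pow_one]

@[fun_prop]
theorem continuous_expectation (O : Matrix (Fin d) (Fin d) ℂ) : Continuous (expectation O) := by
  have : expectation O = fun U => ∑ i, ∑ j, O i j *
      colMonomial (Pi.single j 1) (Pi.single i 1) U := funext (expectation_eq_sum O)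
  rw [this]
  fun_prop

theorem isHermitian_rotatedState (U : Matrix.unitaryGroup (Fin d) ℂ) :
    (rotatedState d U).IsHermitian := by
  ext i j
  simp [rotatedState_apply, mul_comm]

theorem expectation_re {O : Matrix (Fin d) (Fin d) ℂ} (hO : O.IsHermitian)
    (U : Matrix.unitaryGroup (Fin d) ℂ) : ((expectation O U).re : ℂ) = expectation O U := by
  refine Complex.conj_eq_iff_re.mp ?_
  rw [expectation]
  change star (O * rotatedState d U).trace = _
  rw [← Matrix.trace_conjTranspose, Matrix.conjTranspose_mul, hO.eq,
    (isHermitian_rotatedState U).eq, Matrix.trace_mul_comm]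

theorem integrable_bornLaw (hd : 2 ≤ d) (p q : ℕ) {f : Matrix.unitaryGroup (Fin d) ℂ → ℂ}
    (hf : Continuous f) : Integrable f (bornLaw d p q) := by
  have := isProbabilityMeasure_bornLaw hd p q
  exact hf.integrable_of_hasCompactSupport (HasCompactSupport.of_compactSpace f)

/-- Only the diagonal of `O` survives phase invariance, and under the Born law `|φ_i|²` has mean
`(a_i + 1)/(n + d)`, where `a_i` is the step exponent. The `1` contributes the trace and the `a_i`
the two remaining terms. -/
theorem integral_expectation (hd : 2 ≤ d) (p q : ℕ) (O : Matrix (Fin d) (Fin d) ℂ) :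
    ((p + q : ℕ) + d : ℂ) * ∫ U, expectation O U ∂bornLaw d p q =
      O.trace + p * O 0 0 + q * O 1 1 := by
  have hK := norm_mul_colMoment_stepExponent hd p q
  have hterm : ∀ i j : Fin d, ((p + q : ℕ) + d : ℂ) *
      ∫ U, O i j * colMonomial (Pi.single j 1) (Pi.single i 1) U ∂bornLaw d p q =
      if j = i then O i j * (stepExponent d p q i + 1) else 0 := by
    intro i j
    rw [integral_const_mul, integral_bornLaw_colMonomial]
    split_ifs with h
    · subst h
      have := colMoment_add_single (stepExponent d p q) j
      rw [sum_stepExponent] at this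
      linear_combination O j j * (symDim d (p + q) * (p + q).choose p : ℕ) * this +
        O j j * (stepExponent d p q j + 1) * hK
    · rw [colMoment_eq_zero_of_ne]
      · simp
      · intro h'
        have := congrFun (add_left_cancel h') j
        simp [h] at this
  simp only [expectation_eq_sum]
  rw [integral_finsetSum _ fun i _ => integrable_bornLaw hd p q (by fun_prop), Finset.mul_sum]
  rw [Finset.sum_congr rfl fun i _ => by
    rw [integral_finsetSum _ fun j _ => integrable_bornLaw hd p q (by fun_prop), Finset.mul_sum,
      Finset.sum_congr rfl fun j _ => hterm i j]]
  simp only [Finset.sum_ite_eq', Finset.mem_univ, if_true, mul_add, mul_one,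
    Finset.sum_add_distrib, sum_mul_stepExponent]
  rw [Matrix.trace]
  simp only [Matrix.diag_apply]
  ring

theorem integral_expectation_sq (hd : 2 ≤ d) (p q : ℕ) (O : Matrix (Fin d) (Fin d) ℂ) :
    ((p + q : ℕ) + d : ℂ) * ((p + q : ℕ) + d + 1) * ∫ U, expectation O U ^ 2 ∂bornLaw d p q =
      (O.trace + p * O 0 0 + q * O 1 1) ^ 2 + (O ^ 2).trace + 2 * p * (O ^ 2) 0 0 +
        2 * q * (O ^ 2) 1 1 + 2 * p * q * (O 0 1 * O 1 0) - p * O 0 0 ^ 2 - q * O 1 1 ^ 2 := by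
  have hK := norm_mul_colMoment_stepExponent hd p q
  set a : Fin d → ℂ := fun i => stepExponent d p q i
  have hterm : ∀ i j m l : Fin d, ((p + q : ℕ) + d : ℂ) * ((p + q : ℕ) + d + 1) *
      ∫ U, O i j * O m l *
        colMonomial (Pi.single j 1 + Pi.single l 1) (Pi.single i 1 + Pi.single m 1) U
        ∂bornLaw d p q =
      (if j = i then if l = m then O i j * O m l * ((a i + 1) * (a m + 1)) else 0 else 0) +
        (if l = i then if j = m then O i j * O m l * ((a i + 1) * (a m + 1)) else 0 else 0) -
        (if j = i then if l = m then if m = i then O i j * O m l * ((a i + 1) * a i)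
          else 0 else 0 else 0) := by
    intro i j m l
    rw [integral_const_mul, integral_bornLaw_colMonomial]
    have := colMoment_bidegree_two (stepExponent d p q) i j m l
    rw [sum_stepExponent] at this
    calc _ = O i j * O m l * (((if j = i then if l = m then (a i + 1) * (a m + 1) else 0 else 0) +
        (if l = i then if j = m then (a i + 1) * (a m + 1) else 0 else 0) -
        (if j = i then if l = m then if m = i then (a i + 1) * a i else 0 else 0 else 0))) := by
          linear_combination O i j * O m l * (symDim d (p + q) * (p + q).choose p : ℕ) * this +
            O i j * O m l * (((if j = i then if l = m then (a i + 1) * (a m + 1) else 0 else 0) +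
        (if l = i then if j = m then (a i + 1) * (a m + 1) else 0 else 0) -
        (if j = i then if l = m then if m = i then (a i + 1) * a i else 0 else 0 else 0))) * hK
      _ = _ := by simp only [mul_add, mul_sub, mul_ite, mul_zero]
  have hsq : ∀ U, expectation O U ^ 2 = ∑ i, ∑ j, ∑ m, ∑ l, O i j * O m l *
      colMonomial (Pi.single j 1 + Pi.single l 1) (Pi.single i 1 + Pi.single m 1) U := by
    intro U
    rw [sq, expectation_eq_sum]
    simp only [Finset.sum_mul, Finset.mul_sum, colMonomial_add]
    refine Finset.sum_congr rfl fun i _ => Finset.sum_congr rfl fun j _ =>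
      Finset.sum_congr rfl fun m _ => Finset.sum_congr rfl fun l _ => by ring
  have hint : ((p + q : ℕ) + d : ℂ) * ((p + q : ℕ) + d + 1) *
      ∫ U, expectation O U ^ 2 ∂bornLaw d p q =
      ∑ i, ∑ j, ∑ m, ∑ l, ((p + q : ℕ) + d : ℂ) * ((p + q : ℕ) + d + 1) *
        ∫ U, O i j * O m l *
          colMonomial (Pi.single j 1 + Pi.single l 1) (Pi.single i 1 + Pi.single m 1) U
          ∂bornLaw d p q := by
    simp only [hsq, ← Finset.mul_sum]
    congr 1
    rw [integral_finsetSum _ fun i _ => integrable_bornLaw hd p q (by fun_prop)]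
    refine Finset.sum_congr rfl fun i _ => ?_
    rw [integral_finsetSum _ fun i _ => integrable_bornLaw hd p q (by fun_prop)]
    refine Finset.sum_congr rfl fun j _ => ?_
    rw [integral_finsetSum _ fun i _ => integrable_bornLaw hd p q (by fun_prop)]
    refine Finset.sum_congr rfl fun m _ => ?_
    rw [integral_finsetSum _ fun i _ => integrable_bornLaw hd p q (by fun_prop)]
  rw [hint]
  simp only [hterm, Finset.sum_add_distrib, Finset.sum_sub_distrib]
  have hdiag : ∑ i, O i i * (a i + 1) = O.trace + p * O 0 0 + q * O 1 1 := by
    simp only [mul_add, mul_one, Finset.sum_add_distrib, a, sum_mul_stepExponent]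
    rw [Matrix.trace]
    simp only [Matrix.diag_apply]
    ring
  have hO2 : ∀ i, (O ^ 2) i i = ∑ m, O i m * O m i := by
    intro i
    rw [sq, Matrix.mul_apply]
  -- The matching `j = i, l = m` reproduces the squared first-moment numerator. The crossed matching
  -- below produces the entries of `O²`, and the coincidence term then removes `p(p+1)` and `q(q+1)`
  -- multiples of squared diagonal entries.
  have h1 : ∑ i, ∑ j, ∑ m, ∑ l, (if j = i then if l = m then
      O i j * O m l * ((a i + 1) * (a m + 1)) else 0 else 0) =
      (O.trace + p * O 0 0 + q * O 1 1) ^ 2 := by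
    rw [← hdiag, sq, Finset.sum_mul_sum]
    refine Finset.sum_congr rfl fun i _ => ?_
    rw [Finset.sum_eq_single_of_mem i (Finset.mem_univ i) fun j _ hj => by simp [hj]]
    refine Finset.sum_congr rfl fun m _ => ?_
    simp
    ring
  have h2 : ∑ i, ∑ j, ∑ m, ∑ l, (if l = i then if j = m then
      O i j * O m l * ((a i + 1) * (a m + 1)) else 0 else 0) =
      ∑ i, ∑ m, O i m * O m i * ((a i + 1) * (a m + 1)) := by
    refine Finset.sum_congr rfl fun i _ => ?_
    rw [Finset.sum_comm]
    refine Finset.sum_congr rfl fun m _ => ?_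
    simp
  have h3 : ∑ i, ∑ j, ∑ m, ∑ l, (if j = i then if l = m then if m = i then
      O i j * O m l * ((a i + 1) * a i) else 0 else 0 else 0) =
      ∑ i, O i i * O i i * (a i + 1) * a i := by
    refine Finset.sum_congr rfl fun i _ => ?_
    rw [Finset.sum_eq_single_of_mem i (Finset.mem_univ i) fun j _ hj => by simp [hj]]
    simp
    ring
  have h4 : ∑ i, ∑ m, O i m * O m i * ((a i + 1) * (a m + 1)) =
      (O ^ 2).trace + 2 * p * (O ^ 2) 0 0 + 2 * q * (O ^ 2) 1 1 + 2 * p * q * (O 0 1 * O 1 0) +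
        p ^ 2 * O 0 0 ^ 2 + q ^ 2 * O 1 1 ^ 2 := by
    -- The inner sum is written as an affine function of `a i`. In its constant part the factors are
    -- commuted so that summing over `i` gives entries of `O²` literally.
    have hinner : ∀ i, ∑ m, O i m * O m i * ((a i + 1) * (a m + 1)) =
        ((O ^ 2) i i + (p * (O i 0 * O 0 i) + q * (O i 1 * O 1 i))) * a i +
          ((O ^ 2) i i + (p * (O 0 i * O i 0) + q * (O 1 i * O i 1))) := by
      intro i
      rw [hO2, ← sum_mul_stepExponent p q fun m => O i m * O m i]
      have : ∀ m, O i m * O m i * ((a i + 1) * (a m + 1)) =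
          (O i m * O m i + O i m * O m i * a m) * (a i + 1) := fun m => by ring
      simp only [this, ← Finset.sum_mul, Finset.sum_add_distrib]
      have h' := sum_mul_stepExponent p q fun m => O i m * O m i
      simp only [a, h']
      ring
    simp only [hinner, Finset.sum_add_distrib, a, sum_mul_stepExponent, ← Finset.mul_sum, ← hO2]
    rw [Matrix.trace]
    simp only [Matrix.diag_apply]
    ring
  have h5 : ∑ i, O i i * O i i * (a i + 1) * a i =
      p * (O 0 0 ^ 2 * (p + 1)) + q * (O 1 1 ^ 2 * (q + 1)) := by
    simp only [a]
    rw [sum_mul_stepExponent p q fun i => O i i * O i i * ((stepExponent d p q i : ℂ) + 1),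
      stepExponent_zero hd, stepExponent_one hd]
    ring
  rw [h1, h2, h3, h4, h5]
  ring

theorem estimate_inl_rotatedState (hn : 0 < n) (O : Matrix (Fin d) (Fin d) ℂ)
    (U : Matrix.unitaryGroup (Fin d) ℂ) :
    estimate (Composition.single n hn) O (Sum.inl fun _ => rotatedState d U) =
      (n + d : ℝ) * (expectation O U).re := by
  have : shadow (Composition.single n hn) (Sum.inl fun _ => rotatedState d U) =
      ((d + n : ℕ) : ℂ) • rotatedState d U := by
    rw [shadow, Fintype.sum_unique]
    rfl
  rw [estimate, this, Matrix.mul_smul, Matrix.trace_smul, expectation, smul_eq_mul,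
    ← Complex.ofReal_natCast, Complex.re_ofReal_mul]
  push_cast
  ring

theorem memLp_estimate_bornLaw (hd : 2 ≤ d) (n : ℕ) (p q : ℕ)
    (O : Matrix (Fin d) (Fin d) ℂ) :
    MemLp (fun U => (n + d : ℝ) * (expectation O U).re) 2 (bornLaw d p q) := by
  have := isProbabilityMeasure_bornLaw hd p q
  have hc : Continuous fun U => (n + d : ℝ) * (expectation O U).re :=
    continuous_const.mul (Complex.continuous_re.comp (continuous_expectation O))
  exact hc.memLp_of_hasCompactSupport (HasCompactSupport.of_compactSpace _)

theorem measurable_inl_rotatedState (hn : 0 < n) :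
    Measurable fun U : Matrix.unitaryGroup (Fin d) ℂ =>
      (Sum.inl fun _ => rotatedState d U : Outcome d (Composition.single n hn)) :=
  measurable_inl.comp (measurable_pi_lambda _ fun _ => measurable_rotatedState)

variable {hn : 0 < n} {p q : ℕ} {τ : Str n d → ℂ} {O : Matrix (Fin d) (Fin d) ℂ}

theorem Setup.isProbabilityMeasure_outcomeLaw (h : Setup n hn d p q τ O) :
    IsProbabilityMeasure (outcomeLaw d (Composition.single n hn) (pureState τ)) := by
  rw [h.outcomeLaw_eq]
  have := isProbabilityMeasure_bornLaw h.two_le p q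
  exact Measure.isProbabilityMeasure_map (measurable_inl_rotatedState hn).aemeasurable

theorem Setup.memLp_estimate (h : Setup n hn d p q τ O) :
    MemLp (estimate (Composition.single n hn) O) 2
      (outcomeLaw d (Composition.single n hn) (pureState τ)) := by
  rw [h.outcomeLaw_eq, memLp_map_measure_iff (measurable_estimate _ _).aestronglyMeasurable
    (measurable_inl_rotatedState hn).aemeasurable]
  refine (memLp_estimate_bornLaw h.two_le n p q O).congr_norm ?_ ?_
  · exact ((measurable_estimate _ _).comp (measurable_inl_rotatedState hn)).aestronglyMeasurable
  · exact ae_of_all _ fun U => by rw [Function.comp_apply, estimate_inl_rotatedState]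

theorem Setup.estimateVar_eq (h : Setup n hn d p q τ O) :
    estimateVar (Composition.single n hn) τ O =
      ((n : ℝ) + d) / ((n : ℝ) + d + 1) *
        ((O ^ 2).trace.re + 2 * p * ((O ^ 2) 0 0).re + 2 * q * ((O ^ 2) 1 1).re
          + 2 * p * q * ‖O 0 1‖ ^ 2
          - p * (O 0 0).re ^ 2 - q * (O 1 1).re ^ 2)
      - 1 / ((n : ℝ) + d + 1) *
        ((p : ℝ) ^ 2 * (O 0 0).re ^ 2 + (q : ℝ) ^ 2 * (O 1 1).re ^ 2
          + 2 * p * q * (O 0 0).re * (O 1 1).re) := by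
  have := isProbabilityMeasure_bornLaw h.two_le p q
  have hO := h.hermitian
  have hd : (0 : ℝ) < n + d := by
    have : 0 < n + d := by omega
    exact_mod_cast this
  rw [estimateVar, h.outcomeLaw_eq, variance_map (measurable_estimate _ _).aemeasurable
    (measurable_inl_rotatedState hn).aemeasurable]
  have hcomp : estimate (Composition.single n hn) O ∘
      (fun U : Matrix.unitaryGroup (Fin d) ℂ => Sum.inl fun _ => rotatedState d U) =
      fun U => (n + d : ℝ) * (expectation O U).re :=
    funext fun U => estimate_inl_rotatedState hn O U
  rw [hcomp, variance_eq_sub (memLp_estimate_bornLaw h.two_le n p q O)]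
  have hdiag : ∀ i, ((O i i).re : ℂ) = O i i := fun i =>
    Complex.conj_eq_iff_re.mp (hO.apply i i)
  have hO2 : (O ^ 2).IsHermitian := hO.pow 2
  have hdiag2 : ∀ i, (((O ^ 2) i i).re : ℂ) = (O ^ 2) i i := fun i =>
    Complex.conj_eq_iff_re.mp (hO2.apply i i)
  have htr2 : ((O ^ 2).trace.re : ℂ) = (O ^ 2).trace := by
    refine Complex.conj_eq_iff_re.mp ?_
    change star (O ^ 2).trace = _
    rw [← Matrix.trace_conjTranspose, hO2.eq]
  have hoff : ((‖O 0 1‖ ^ 2 : ℝ) : ℂ) = O 0 1 * O 1 0 := by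
    rw [← hO.apply 1 0, ← Complex.normSq_eq_norm_sq, ← Complex.mul_conj]
    rfl
  have hmean : ∫ U, (n + d : ℝ) * (expectation O U).re ∂bornLaw d p q =
      p * (O 0 0).re + q * (O 1 1).re := by
    apply Complex.ofReal_injective
    have h1 := integral_expectation h.two_le p q O
    rw [h.traceless, h.add_eq] at h1
    rw [integral_const_mul, Complex.ofReal_mul, ← integral_complex_ofReal]
    simp only [expectation_re hO]
    push_cast
    rw [h1, hdiag, hdiag]
    ring
  have hsecond : (n + d + 1 : ℝ) *
      ∫ U, ((n + d : ℝ) * (expectation O U).re) ^ 2 ∂bornLaw d p q =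
      (n + d : ℝ) * ((p * (O 0 0).re + q * (O 1 1).re) ^ 2 + (O ^ 2).trace.re +
        2 * p * ((O ^ 2) 0 0).re + 2 * q * ((O ^ 2) 1 1).re + 2 * p * q * ‖O 0 1‖ ^ 2
          - p * (O 0 0).re ^ 2 - q * (O 1 1).re ^ 2) := by
    apply Complex.ofReal_injective
    have h1 := integral_expectation_sq h.two_le p q O
    rw [h.traceless, h.add_eq, zero_add] at h1
    simp only [mul_pow]
    rw [integral_const_mul, Complex.ofReal_mul, Complex.ofReal_mul, ← integral_complex_ofReal]
    rw [Complex.ofReal_mul]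
    simp only [Complex.ofReal_add, Complex.ofReal_sub, Complex.ofReal_mul, Complex.ofReal_pow,
      expectation_re hO, hdiag, hdiag2, htr2, Complex.ofReal_natCast, Complex.ofReal_one,
      Complex.ofReal_ofNat]
    have hoff' := hoff
    rw [Complex.ofReal_pow] at hoff'
    rw [hoff']
    linear_combination (n + d : ℂ) * h1
  have hpow : (∫ U, ((fun U => (n + d : ℝ) * (expectation O U).re) ^ 2) U ∂bornLaw d p q) =
      ∫ U, ((n + d : ℝ) * (expectation O U).re) ^ 2 ∂bornLaw d p q := rfl
  rw [hpow, hmean]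
  have hd1 : (n + d + 1 : ℝ) ≠ 0 := by positivity
  rw [mul_comm, ← eq_div_iff hd1] at hsecond
  rw [hsecond]
  -- The squared mean occurs with factor `(n+d)/(n+d+1)` in the second moment and is then subtracted
  -- once, which leaves the coefficient `-1/(n+d+1)`.
  field_simp
  ring

omit [NeZero d] in
-- For Hermitian `O`, the diagonal entry `(O ^ 2) i i` is the sum of `|O i j|²` over `j`.
theorem sq_le_re_sq_apply {O : Matrix (Fin d) (Fin d) ℂ} (hO : O.IsHermitian) (i j : Fin d) :
    ‖O i j‖ ^ 2 ≤ ((O ^ 2) i i).re := by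
  have h : ∀ j, (O i j * O j i).re = ‖O i j‖ ^ 2 := by
    intro j
    rw [← hO.apply j i, ← Complex.normSq_eq_norm_sq]
    change (O i j * (starRingEnd ℂ) (O i j)).re = _
    rw [Complex.mul_conj, Complex.ofReal_re]
  rw [sq O, Matrix.mul_apply, Complex.re_sum]
  simp only [h]
  exact Finset.single_le_sum (f := fun j => ‖O i j‖ ^ 2) (fun _ _ => by positivity)
    (Finset.mem_univ j)

/-- With a Hadamard block the variance is at least quadratic. -/
theorem Setup.mul_le_estimateVar (h : Setup n hn d p q τ O) (hb : HasHadamardBlock O) :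
    (p * q : ℝ) ≤ estimateVar (Composition.single n hn) τ O := by
  have hO := h.hermitian
  have h0 : (1 : ℝ) ≤ ((O ^ 2) 0 0).re := by
    simpa [hb.1] using sq_le_re_sq_apply hO 0 0
  have h1 : (1 : ℝ) ≤ ((O ^ 2) 1 1).re := by
    simpa [hb.2.2.2] using sq_le_re_sq_apply hO 1 1
  have htr : 0 ≤ (O ^ 2).trace.re := by
    rw [Matrix.trace, Complex.re_sum]
    exact Finset.sum_nonneg fun i _ => (sq_nonneg _).trans (sq_le_re_sq_apply hO i i)
  rw [h.estimateVar_eq, hb.1, hb.2.1, hb.2.2.2]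
  have hpq : (n : ℝ) = p + q := by exact_mod_cast h.add_eq.symm
  have hp : (0 : ℝ) ≤ p := Nat.cast_nonneg p
  have hq : (0 : ℝ) ≤ q := Nat.cast_nonneg q
  have hd : (2 : ℝ) ≤ d := by exact_mod_cast h.two_le
  have hn1 : (1 : ℝ) ≤ n := by exact_mod_cast hn
  have hpos : (0 : ℝ) < n + d + 1 := by positivity
  -- The diagonal entries of `O²` are at least `1`, so `2p + 2q` pays for the subtracted `p + q` and
  -- leaves a surplus `n`.
  have hbr : 2 * p * q + n ≤ (O ^ 2).trace.re + 2 * p * ((O ^ 2) 0 0).re +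
      2 * q * ((O ^ 2) 1 1).re + 2 * p * q - p - q := by
    nlinarith
  -- The negative term is harmless: `(p - q)² = n² - 4pq`, and the surplus contributes `n(n + d) ≥
  -- n²` over the same denominator.
  have key : (p * q : ℝ) ≤ (n + d) / (n + d + 1) * (2 * p * q + n) - 1 / (n + d + 1) *
      (p - q) ^ 2 := by
    rw [div_mul_eq_mul_div, div_mul_eq_mul_div, ← sub_div, le_div_iff₀ hpos, hpq]
    rw [hpq] at hn1
    nlinarith [mul_nonneg hp hq, mul_nonneg (mul_nonneg hp hq) (by linarith : (0 : ℝ) ≤ d - 1),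
      mul_nonneg (mul_nonneg hp hq) (by linarith : (0 : ℝ) ≤ p + q)]
  have hmul := mul_le_mul_of_nonneg_left hbr (by positivity : 0 ≤ (n + d : ℝ) / (n + d + 1))
  refine key.trans ?_
  simp only [Complex.one_re, Complex.neg_re, norm_one]
  linarith

end Variance

end QuditShadow
-- Assembly of the three claims.
open QuditShadow in
theorem mainTheorem7 :
    -- the exact formula
    (∀ (n : ℕ) (hn : 0 < n) (d : ℕ) [NeZero d] (p q : ℕ) (τ : Str n d → ℂ)
        (O : Matrix (Fin d) (Fin d) ℂ), Setup n hn d p q τ O →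
      IsProbabilityMeasure (outcomeLaw d (Composition.single n hn) (pureState τ)) ∧
      MemLp (estimate (Composition.single n hn) O) 2
        (outcomeLaw d (Composition.single n hn) (pureState τ)) ∧
      estimateVar (Composition.single n hn) τ O =
        ((n : ℝ) + d) / ((n : ℝ) + d + 1) *
          ((O ^ 2).trace.re + 2 * p * ((O ^ 2) 0 0).re + 2 * q * ((O ^ 2) 1 1).re
            + 2 * p * q * ‖O 0 1‖ ^ 2
            - p * (O 0 0).re ^ 2 - q * (O 1 1).re ^ 2)
        - 1 / ((n : ℝ) + d + 1) *
          ((p : ℝ) ^ 2 * (O 0 0).re ^ 2 + (q : ℝ) ^ 2 * (O 1 1).re ^ 2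
            + 2 * p * q * (O 0 0).re * (O 1 1).re)) ∧
    -- the scaled variance is bounded below when `p, q = Θ(n)` (here `p, q ≤ n` is automatic)
    (∃ C₁ : ℝ, 0 < C₁ ∧ ∀ c : ℝ, 0 < c → ∃ C₂ : ℝ, 0 < C₂ ∧ ∃ N : ℕ,
      ∀ (n : ℕ) (hn : 0 < n) (d : ℕ) [NeZero d] (p q : ℕ) (τ : Str n d → ℂ)
        (O : Matrix (Fin d) (Fin d) ℂ), Setup n hn d p q τ O → HasHadamardBlock O →
        N ≤ n → c * n ≤ p → c * n ≤ q →
        C₁ * (((p : ℝ) * q / (n : ℝ) ^ 2) * ‖O 0 1‖ ^ 2) ≤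
            1 / (n : ℝ) ^ 2 * estimateVar (Composition.single n hn) τ O ∧
          C₂ ≤ C₁ * (((p : ℝ) * q / (n : ℝ) ^ 2) * ‖O 0 1‖ ^ 2)) ∧
    -- no bound of the form `A tr(O²) + B n ‖O²‖` holds, whatever the constants
    (∀ (d : ℕ) [NeZero d] (O : Matrix (Fin d) (Fin d) ℂ), 2 ≤ d → O.IsHermitian → O.trace = 0 →
      HasHadamardBlock O → ∀ c : ℝ, 0 < c → ∀ A B : ℝ, ∃ N : ℕ,
      ∀ (n : ℕ) (hn : 0 < n) (p q : ℕ), p + q = n → N ≤ n → c * n ≤ p → c * n ≤ q →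
        ∃ τ : Str n d → ℂ, Setup n hn d p q τ O ∧
          A * (O ^ 2).trace.re + B * n * specNorm (O ^ 2) <
            estimateVar (Composition.single n hn) τ O) := by
  -- Since `p * q ≤ Var` for all `n`, the constants `C₁ = 1`, `C₂ = c ^ 2` and the threshold `0`
  -- suffice.
  refine ⟨fun n hn d _ p q τ O h => ⟨h.isProbabilityMeasure_outcomeLaw, h.memLp_estimate,
    h.estimateVar_eq⟩, ⟨1, one_pos, fun c hc => ⟨c ^ 2, by positivity, 0, ?_⟩⟩, ?_⟩
  · intro n hn d _ p q τ O h hb _ hp hq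
    have hn' : (0 : ℝ) < n := by exact_mod_cast hn
    rw [hb.2.1, norm_one, one_pow, mul_one, one_mul, one_div_mul_eq_div]
    constructor
    · gcongr
      exact h.mul_le_estimateVar hb
    · rw [le_div_iff₀ (by positivity)]
      calc c ^ 2 * (n : ℝ) ^ 2 = (c * n) * (c * n) := by ring
        _ ≤ p * q := by gcongr
  · intro d _ O hd hO htr hb c hc A B
    set S := A * (O ^ 2).trace.re
    set T := B * specNorm (O ^ 2)
    -- The claimed bound is `S + n T ≤ n(|S| + |T|)`, which falls below `c² n² ≤ p q` once `n`
    -- exceeds this quotient; the absolute values allow `A` and `B` of either sign.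
    obtain ⟨N, hN⟩ := exists_nat_gt ((|S| + |T|) / c ^ 2)
    refine ⟨N, fun n hn p q hpq hNn hp hq => ?_⟩
    obtain ⟨τ, h⟩ := exists_setup hn hd hpq hO htr
    refine ⟨τ, h, lt_of_lt_of_le ?_ (h.mul_le_estimateVar hb)⟩
    have hn1 : (1 : ℝ) ≤ n := by exact_mod_cast hn
    have hNn' : (N : ℝ) ≤ n := by exact_mod_cast hNn
    have hST : |S| + |T| < n * c ^ 2 := by
      rw [div_lt_iff₀ (by positivity)] at hN
      exact hN.trans_le (by gcongr)
    calc A * (O ^ 2).trace.re + B * n * specNorm (O ^ 2) = S + n * T := by simp only [S, T]; ring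
      _ ≤ n * |S| + n * |T| := by
        have h1 : S ≤ n * |S| := (le_abs_self S).trans (le_mul_of_one_le_left (abs_nonneg S) hn1)
        have h2 : n * T ≤ n * |T| := by gcongr; exact le_abs_self T
        linarith
      _ = n * (|S| + |T|) := by ring
      _ < n * (n * c ^ 2) := by gcongr
      _ = (c * n) * (c * n) := by ring
      _ ≤ p * q := by gcongr
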